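/- Let $n\ge 4$, $R>0$ and $\lambda<n-2$, and let $B_R$ denote the open ball of radius $R$ centred at $0$ in $\mathbb R^n$. Let $P$ be a positive $C^1$ function on $(0,R)$ which is an HI-potential (Hardy improving potential) on $(0,R)$, that is, the equation $$y''+\frac1r\,y'+P(r)\,y=0$$ has a positive solution on $(0,R)$. Let $$\beta(P;R):=\inf_{u\in H^1_0(B_R),\ u\ne 0}\ \frac{\displaystyle\int_{B_R}|\nabla u|^2\,dx-\frac{(n-2)^2}{4}\int_{B_R}\frac{u^2}{|x|^2}\,dx}{\displaystyle\int_{B_R}P(|x|)\,u^2\,dx}$$ be the best constant in the corresponding improved Hardy inequality. Assume that $$\frac{P_r(r)}{P(r)}=-\frac{\lambda}{r}+f(r)\quad\text{on }(0,R),\qquad f\ge 0,\qquad \lim_{r\to0^+}r f(r)=0.$$ Then for every (bounded) open set $\Omega\subset B_R$ with $0\in\Omega$ and every real-valued $u\in H^2_0(\Omega)$, $$\int_\Omega|\Delta u|^2\,dx\ \ge\ \frac{n^2(n-4)^2}{16}\int_\Omega\frac{u^2}{|x|^4}\,dx+\frac{\beta(P;R)\,\bigl(n^2+(n-\lambda-2)^2\bigr)}{4}\int_\Omega\frac{P(|x|)}{|x|^2}\,u^2\,dx,$$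 where all integrals are finite, except that for $n=4$ the integral $\int_\Omega u^2|x|^{-4}dx$, whose coefficient is $0$, may diverge; that term is then read as $0$. -/

import Mathlib

open MeasureTheory Filter Topology Set
open scoped ContDiff

/-- Smooth functions with compact support contained in `Ω`, i.e. `C_c^∞(Ω)`. -/
def IsTestFunction {n : ℕ} (Ω : Set (EuclideanSpace ℝ (Fin n)))
    (φ : EuclideanSpace ℝ (Fin n) → ℝ) : Prop :=
  ContDiff ℝ ∞ φ ∧ HasCompactSupport φ ∧ tsupport φ ⊆ Ω

/-- Classical partial derivative `∂φ/∂x_i`. -/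
noncomputable def partialDeriv {n : ℕ} (i : Fin n) (φ : EuclideanSpace ℝ (Fin n) → ℝ)
    (x : EuclideanSpace ℝ (Fin n)) : ℝ :=
  fderiv ℝ φ x (EuclideanSpace.single i 1)

/-- `v` is the weak partial derivative `∂u/∂x_i` on `Ω`. It is only used for `u, v ∈ L²(Ω)`,
so that both integrals converge. -/
def IsWeakPartial {n : ℕ} (Ω : Set (EuclideanSpace ℝ (Fin n))) (i : Fin n)
    (u v : EuclideanSpace ℝ (Fin n) → ℝ) : Prop :=
  ∀ φ : EuclideanSpace ℝ (Fin n) → ℝ, IsTestFunction Ω φ →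
    ∫ x in Ω, u x * partialDeriv i φ x = - ∫ x in Ω, v x * φ x

/-- Convergence in `L²(Ω)`. -/
def TendstoL2 {n : ℕ} (Ω : Set (EuclideanSpace ℝ (Fin n)))
    (w : ℕ → EuclideanSpace ℝ (Fin n) → ℝ) (v : EuclideanSpace ℝ (Fin n) → ℝ) : Prop :=
  Tendsto (fun k => eLpNorm (w k - v) 2 (volume.restrict Ω)) atTop (𝓝 0)

/-- `u ∈ H^1_0(Ω)` (the closure of `C_c^∞(Ω)` in `H^1(Ω)`), with weak gradient `Du`. -/
structure IsH10 {n : ℕ} (Ω : Set (EuclideanSpace ℝ (Fin n)))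
    (u : EuclideanSpace ℝ (Fin n) → ℝ) (Du : Fin n → EuclideanSpace ℝ (Fin n) → ℝ) : Prop where
  memLp : MemLp u 2 (volume.restrict Ω)
  memLp_grad : ∀ i, MemLp (Du i) 2 (volume.restrict Ω)
  weak_grad : ∀ i, IsWeakPartial Ω i u (Du i)
  approx : ∃ φ : ℕ → EuclideanSpace ℝ (Fin n) → ℝ,
    (∀ k, IsTestFunction Ω (φ k)) ∧
    TendstoL2 Ω φ u ∧
    ∀ i, TendstoL2 Ω (fun k => partialDeriv i (φ k)) (Du i)

/-- `u ∈ H^2_0(Ω)` (the closure of `C_c^∞(Ω)` in `H^2(Ω)`), with weak gradient `Du` and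
weak Hessian `D2u`. -/
structure IsH20 {n : ℕ} (Ω : Set (EuclideanSpace ℝ (Fin n)))
    (u : EuclideanSpace ℝ (Fin n) → ℝ) (Du : Fin n → EuclideanSpace ℝ (Fin n) → ℝ)
    (D2u : Fin n → Fin n → EuclideanSpace ℝ (Fin n) → ℝ) : Prop where
  memLp : MemLp u 2 (volume.restrict Ω)
  memLp_grad : ∀ i, MemLp (Du i) 2 (volume.restrict Ω)
  memLp_hess : ∀ i j, MemLp (D2u i j) 2 (volume.restrict Ω)
  weak_grad : ∀ i, IsWeakPartial Ω i u (Du i)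
  weak_hess : ∀ i j, IsWeakPartial Ω j (Du i) (D2u i j)
  approx : ∃ φ : ℕ → EuclideanSpace ℝ (Fin n) → ℝ,
    (∀ k, IsTestFunction Ω (φ k)) ∧
    TendstoL2 Ω φ u ∧
    (∀ i, TendstoL2 Ω (fun k => partialDeriv i (φ k)) (Du i)) ∧
    ∀ i j, TendstoL2 Ω (fun k => partialDeriv j (partialDeriv i (φ k))) (D2u i j)

/-- `P` is a Hardy improving potential on `(0, R)`: a nonnegative `C^1` function such that
`y'' + y'/r + P(r) y = 0` has a positive solution on `(0, R)`. -/
structure IsHIPotential (P : ℝ → ℝ) (R : ℝ) : Prop where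
  contDiffOn : ContDiffOn ℝ 1 P (Ioo 0 R)
  nonneg : ∀ r ∈ Ioo 0 R, 0 ≤ P r
  exists_pos_solution : ∃ y : ℝ → ℝ, ContDiffOn ℝ 2 y (Ioo 0 R) ∧
    ∀ r ∈ Ioo 0 R, 0 < y r ∧ deriv (deriv y) r + 1 / r * deriv y r + P r * y r = 0

/-- The best constant `β(P; R)` in the improved Hardy inequality on the ball `B_R ⊆ ℝⁿ`: the
infimum over `0 ≠ u ∈ H^1_0(B_R)` of
`(∫ |∇u|² - (n-2)²/4 ∫ u²/|x|²) / ∫ P(|x|) u²`. -/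
noncomputable def hardyBeta (n : ℕ) (P : ℝ → ℝ) (R : ℝ) : ℝ :=
  sInf {q : ℝ | ∃ (u : EuclideanSpace ℝ (Fin n) → ℝ)
      (Du : Fin n → EuclideanSpace ℝ (Fin n) → ℝ),
    IsH10 (Metric.ball 0 R) u Du ∧
    ¬ (u =ᵐ[volume.restrict (Metric.ball 0 R)] 0) ∧
    q = ((∫ x in Metric.ball (0 : EuclideanSpace ℝ (Fin n)) R, ∑ i, Du i x ^ 2)
          - ((n : ℝ) - 2) ^ 2 / 4 *
            ∫ x in Metric.ball (0 : EuclideanSpace ℝ (Fin n)) R, u x ^ 2 / ‖x‖ ^ 2)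
        / ∫ x in Metric.ball (0 : EuclideanSpace ℝ (Fin n)) R, P ‖x‖ * u x ^ 2}

/-! Write `E = x · ∇ = r ∂_r`, and suppose first that `u` is a test function supported away from the
origin. The Laplacian is `Δu = A + B`, with `A` its radial part and `B` the divergence of the
tangential gradient. The cross term `∫ A B` is nonnegative for `n ≥ 4`, so `∫ |Δu|² ≥ ∫ A²`
(`integral_radialLaplacian_sq_le`), and integration by parts gives `∫ A² = ∫ |x|⁻⁴ (E²u - Eu)² +
(n-1) ∫ |x|⁻⁴ (Eu)²`.

The Hardy inequality with constant `β` needs only the radial derivative: on a ray, `v` is the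
profile of a radial function, whose whole gradient is radial, and rays are reassembled in polar
coordinates (`hardyBeta_radial`). For `v / |x|` it reads `∫ |x|⁻⁴ (Ev - v)² ≥ (n-2)²/4 ∫ |x|⁻⁴ v² +
β ∫ P |x|⁻² v²`. With `v = Eu` this gives `∫ A² ≥ n²/4 ∫ |x|⁻⁴ (Eu)² + β ∫ P |x|⁻² (Eu)²`. The first
integral on the right is bounded below by the same inequality with `v = u`, which after expansion
has the Hardy constant `(n-4)²/4`. The second is bounded by a one-dimensional weighted Hardy
inequality with constant `(n-λ-2)²/4`, which follows from the condition on `P'/P`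
(`integral_potential_mul_sq_le`). The sum is the claim.

That `β` is a genuine infimum, and `β ≥ 1`, follows by completing a square with the positive
solution `y`.

To reach `H²_0`, a logarithmic cutoff shows that a point has zero capacity in `H²` when `n ≥ 4`
(`exists_testFunction_approx_away_from_zero`). Fatou's lemma then carries the inequality through
both approximations and yields the finiteness of the weighted integrals
(`lintegral_mul_sq_le_of_tendstoL2`). -/

/-- The Euler operator `x · ∇v`. -/
noncomputable def euler {n : ℕ} (v : EuclideanSpace ℝ (Fin n) → ℝ)
    (x : EuclideanSpace ℝ (Fin n)) : ℝ :=
  fderiv ℝ v x x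

/-- The ball of radius `R` around the origin without its centre. -/
def puncturedBall (n : ℕ) (R : ℝ) : Set (EuclideanSpace ℝ (Fin n)) :=
  Metric.ball 0 R \ {0}

/-! ### Calculus of test functions, partial derivatives and the Euler operator -/

section TestFunctions

variable {n : ℕ} {R : ℝ} {U V : Set (EuclideanSpace ℝ (Fin n))}
  {v w G : EuclideanSpace ℝ (Fin n) → ℝ} {x : EuclideanSpace ℝ (Fin n)}

lemma isOpen_puncturedBall : IsOpen (puncturedBall n R) :=
  Metric.isOpen_ball.sdiff isClosed_singleton

lemma norm_mem_Ioo_of_mem_puncturedBall (hx : x ∈ puncturedBall n R) : ‖x‖ ∈ Ioo 0 R :=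
  ⟨norm_pos_iff.2 hx.2, by simpa using hx.1⟩

lemma IsTestFunction.contDiff (hv : IsTestFunction U v) : ContDiff ℝ ∞ v := hv.1

lemma IsTestFunction.continuous (hv : IsTestFunction U v) : Continuous v := hv.1.continuous

lemma IsTestFunction.hasCompactSupport (hv : IsTestFunction U v) : HasCompactSupport v := hv.2.1

lemma IsTestFunction.differentiable (hv : IsTestFunction U v) : Differentiable ℝ v :=
  hv.1.differentiable (by simp)

lemma IsTestFunction.differentiableAt (hv : IsTestFunction U v) : DifferentiableAt ℝ v x :=
  hv.differentiable x

lemma IsTestFunction.mono (hv : IsTestFunction U v) (h : U ⊆ V) : IsTestFunction V v :=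
  ⟨hv.1, hv.2.1, hv.2.2.trans h⟩

lemma IsTestFunction.eq_zero_of_notMem (hv : IsTestFunction U v) (hx : x ∉ U) : v x = 0 :=
  image_eq_zero_of_notMem_tsupport fun h => hx (hv.2.2 h)

lemma IsTestFunction.add (hv : IsTestFunction U v) (hw : IsTestFunction U w) :
    IsTestFunction U (fun x => v x + w x) :=
  ⟨hv.1.add hw.1, hv.2.1.add hw.2.1,
    (tsupport_add v w).trans (union_subset hv.2.2 hw.2.2)⟩

/-- Off the closed support of `v` the product vanishes locally, so smoothness of `G` on `U` is
enough. This admits weights singular at the origin. -/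
lemma IsTestFunction.smooth_mul (hU : IsOpen U) (hG : ContDiffOn ℝ ∞ G U)
    (hv : IsTestFunction U v) : IsTestFunction U (fun x => G x * v x) := by
  have hs : tsupport (fun x => G x * v x) ⊆ tsupport v := tsupport_mul_subset_right
  refine ⟨?_, hv.2.1.mul_left, hs.trans hv.2.2⟩
  rw [← contMDiff_iff_contDiff]
  refine contMDiff_of_tsupport fun x hx => ContDiffAt.contMDiffAt ?_
  exact (hG.contDiffAt (hU.mem_nhds (hv.2.2 (hs hx)))).mul hv.1.contDiffAt

lemma IsTestFunction.const_mul (c : ℝ) (hv : IsTestFunction U v) :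
    IsTestFunction U (fun x => c * v x) :=
  (hv.mono (subset_univ U)).smooth_mul isOpen_univ contDiffOn_const |>.imp_right fun h =>
    ⟨h.1, tsupport_mul_subset_right.trans hv.2.2⟩

lemma IsTestFunction.mul (hv : IsTestFunction U v) (hw : IsTestFunction U w) :
    IsTestFunction U (fun x => v x * w x) :=
  ⟨hv.1.mul hw.1, hw.2.1.mul_left, tsupport_mul_subset_right.trans hw.2.2⟩

lemma IsTestFunction.sub (hv : IsTestFunction U v) (hw : IsTestFunction U w) :
    IsTestFunction U (fun x => v x - w x) := by
  simpa [sub_eq_add_neg] using hv.add (hw.const_mul (-1))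

lemma IsTestFunction.sum {ι : Type*} (s : Finset ι) {f : ι → EuclideanSpace ℝ (Fin n) → ℝ}
    (hf : ∀ i ∈ s, IsTestFunction U (f i)) : IsTestFunction U (fun x => ∑ i ∈ s, f i x) := by
  classical
  induction s using Finset.induction_on with
  | empty =>
    have h0 : (fun x => ∑ i ∈ ∅, f i x) = (0 : EuclideanSpace ℝ (Fin n) → ℝ) := by ext; simp
    rw [h0]
    exact ⟨contDiff_const, HasCompactSupport.zero, by simp [tsupport]⟩
  | insert a s ha ih =>
    simp only [Finset.sum_insert ha]
    exact (hf a (by simp)).add (ih fun i hi => hf i (by simp [hi]))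

lemma partialDeriv_eq_zero_of_notMem_tsupport (i : Fin n) (hx : x ∉ tsupport v) :
    partialDeriv i v x = 0 := by
  have : fderiv ℝ v x = 0 := by
    by_contra h
    exact hx (support_fderiv_subset ℝ h)
  simp [partialDeriv, this]

lemma euler_eq_sum (v : EuclideanSpace ℝ (Fin n) → ℝ) (x : EuclideanSpace ℝ (Fin n)) :
    euler v x = ∑ i, x i * partialDeriv i v x := by
  have hx : x = ∑ i, x i • EuclideanSpace.single i (1 : ℝ) := by
    ext j
    simp [Finset.sum_apply, Pi.single_apply]
  unfold euler partialDeriv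
  conv_lhs => rw [hx]
  rw [map_sum, ← hx]
  simp

lemma contDiff_coord (i : Fin n) : ContDiff ℝ ∞ (fun x : EuclideanSpace ℝ (Fin n) => x i) :=
  (EuclideanSpace.proj (𝕜 := ℝ) i).contDiff

lemma IsTestFunction.partialDeriv (i : Fin n) (hv : IsTestFunction U v) :
    IsTestFunction U (partialDeriv i v) := by
  have hs : tsupport (_root_.partialDeriv i v) ⊆ tsupport v :=
    closure_minimal (fun x hx => by
      by_contra h
      exact hx (partialDeriv_eq_zero_of_notMem_tsupport i h)) (isClosed_tsupport v)
  refine ⟨?_, hv.2.1.mono' (subset_closure.trans hs), hs.trans hv.2.2⟩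
  exact (hv.1.fderiv_right (m := ∞) (by simp)).clm_apply contDiff_const

lemma IsTestFunction.coord_mul (i : Fin n) (hv : IsTestFunction U v) :
    IsTestFunction U (fun x => x i * v x) :=
  ⟨(contDiff_coord i).mul hv.1, hv.2.1.mul_left, tsupport_mul_subset_right.trans hv.2.2⟩

lemma IsTestFunction.euler (hv : IsTestFunction U v) : IsTestFunction U (euler v) := by
  have : _root_.euler v = fun x => ∑ i, x i * _root_.partialDeriv i v x := by
    ext x; exact euler_eq_sum v x
  rw [this]
  exact IsTestFunction.sum _ fun i _ => (hv.partialDeriv i).coord_mul i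

lemma IsTestFunction.integrable_mul (hU : IsOpen U) (hG : ContinuousOn G U)
    (hv : IsTestFunction U v) : Integrable (fun x => G x * v x) := by
  have hs : tsupport (fun x => G x * v x) ⊆ tsupport v := tsupport_mul_subset_right
  refine Continuous.integrable_of_hasCompactSupport ?_ hv.2.1.mul_left
  refine continuous_of_tsupport fun x hx => ?_
  exact (hG.continuousAt (hU.mem_nhds (hv.2.2 (hs hx)))).mul hv.1.continuous.continuousAt

lemma IsTestFunction.integrable (hv : IsTestFunction U v) : Integrable v :=
  hv.continuous.integrable_of_hasCompactSupport hv.hasCompactSupport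

lemma partialDeriv_mul (i : Fin n) (hv : DifferentiableAt ℝ v x) (hw : DifferentiableAt ℝ w x) :
    partialDeriv i (fun y => v y * w y) x =
      v x * partialDeriv i w x + partialDeriv i v x * w x := by
  simp only [partialDeriv]
  rw [fderiv_fun_mul hv hw]
  simp [mul_comm]

lemma partialDeriv_add (i : Fin n) (hv : DifferentiableAt ℝ v x) (hw : DifferentiableAt ℝ w x) :
    partialDeriv i (fun y => v y + w y) x = partialDeriv i v x + partialDeriv i w x := by
  simp only [partialDeriv]
  rw [fderiv_fun_add hv hw]
  simp

lemma partialDeriv_sub (i : Fin n) (hv : DifferentiableAt ℝ v x) (hw : DifferentiableAt ℝ w x) :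
    partialDeriv i (fun y => v y - w y) x = partialDeriv i v x - partialDeriv i w x := by
  simp only [partialDeriv]
  rw [fderiv_fun_sub hv hw]
  simp

lemma partialDeriv_const_mul (i : Fin n) (c : ℝ) (hv : DifferentiableAt ℝ v x) :
    partialDeriv i (fun y => c * v y) x = c * partialDeriv i v x := by
  simp only [partialDeriv]
  rw [fderiv_const_mul hv]
  simp

lemma partialDeriv_sum (i : Fin n) {ι : Type*} (s : Finset ι)
    {f : ι → EuclideanSpace ℝ (Fin n) → ℝ} (hf : ∀ j ∈ s, DifferentiableAt ℝ (f j) x) :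
    partialDeriv i (fun y => ∑ j ∈ s, f j y) x = ∑ j ∈ s, partialDeriv i (f j) x := by
  simp only [partialDeriv]
  rw [fderiv_fun_sum hf]
  simp

lemma partialDeriv_coord (i j : Fin n) :
    partialDeriv i (fun y => y j) x = if i = j then 1 else 0 := by
  have : fderiv ℝ (fun y : EuclideanSpace ℝ (Fin n) => y j) x = EuclideanSpace.proj j :=
    (EuclideanSpace.proj (𝕜 := ℝ) j).fderiv
  simp only [partialDeriv, this]
  simp [eq_comm]

lemma euler_mul (hv : DifferentiableAt ℝ v x) (hw : DifferentiableAt ℝ w x) :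
    euler (fun y => v y * w y) x = v x * euler w x + euler v x * w x := by
  simp only [euler]
  rw [fderiv_fun_mul hv hw]
  simp [mul_comm]

lemma euler_add (hv : DifferentiableAt ℝ v x) (hw : DifferentiableAt ℝ w x) :
    euler (fun y => v y + w y) x = euler v x + euler w x := by
  simp only [euler]
  rw [fderiv_fun_add hv hw]
  simp

lemma euler_sub (hv : DifferentiableAt ℝ v x) (hw : DifferentiableAt ℝ w x) :
    euler (fun y => v y - w y) x = euler v x - euler w x := by
  simp only [euler]
  rw [fderiv_fun_sub hv hw]
  simp

lemma euler_coord (j : Fin n) : euler (fun y => y j) x = x j := by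
  have : fderiv ℝ (fun y : EuclideanSpace ℝ (Fin n) => y j) x = EuclideanSpace.proj j :=
    (EuclideanSpace.proj (𝕜 := ℝ) j).fderiv
  simp only [euler, this]
  simp

lemma differentiableAt_coord (j : Fin n) :
    DifferentiableAt ℝ (fun y : EuclideanSpace ℝ (Fin n) => y j) x :=
  (contDiff_coord j).differentiable (by simp) x

lemma partialDeriv_comm (i j : Fin n) (hv : ContDiff ℝ ∞ v) :
    partialDeriv i (partialDeriv j v) x = partialDeriv j (partialDeriv i v) x := by
  have h2 : DifferentiableAt ℝ (fderiv ℝ v) x :=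
    ((contDiff_infty.1 hv 2).fderiv_right (m := 1) (by norm_num)).differentiable (by simp) x
  have key : ∀ a b : Fin n, partialDeriv a (partialDeriv b v) x =
      fderiv ℝ (fderiv ℝ v) x (EuclideanSpace.single a 1) (EuclideanSpace.single b 1) := by
    intro a b
    change fderiv ℝ (fun y => fderiv ℝ v y (EuclideanSpace.single b 1)) x _ = _
    rw [fderiv_clm_apply h2 (differentiableAt_const _)]
    simp
  rw [key, key]
  exact ((contDiff_infty.1 hv 2).contDiffAt.isSymmSndFDerivAt (by simp)) _ _

/-- The commutation relation between partial derivatives and the Euler operator. -/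
lemma partialDeriv_euler (i : Fin n) (hv : IsTestFunction U v) :
    partialDeriv i (euler v) x = euler (partialDeriv i v) x + partialDeriv i v x := by
  have : euler v = fun x => ∑ j, x j * partialDeriv j v x := by
    ext x; exact euler_eq_sum v x
  rw [this, partialDeriv_sum i _ fun j _ =>
    ((hv.partialDeriv j).coord_mul j).differentiableAt, euler_eq_sum]
  simp_rw [partialDeriv_mul i (differentiableAt_coord _) (hv.partialDeriv _).differentiableAt,
    partialDeriv_coord, partialDeriv_comm i _ hv.1]
  simp [Finset.sum_add_distrib]

lemma hasFDerivAt_norm_of_ne_zero (hx : x ≠ 0) :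
    HasFDerivAt (fun y : EuclideanSpace ℝ (Fin n) => ‖y‖) (‖x‖⁻¹ • innerSL ℝ x) x := by
  have h := (hasStrictFDerivAt_norm_sq x).hasFDerivAt.sqrt (by positivity)
  simp only [Real.sqrt_sq (norm_nonneg _)] at h
  refine h.congr_fderiv ?_
  rw [two_nsmul, ← two_smul ℝ, smul_smul]
  congr 1
  field_simp

lemma hasFDerivAt_radial {g : ℝ → ℝ} (hx : x ≠ 0) (hg : DifferentiableAt ℝ g ‖x‖) :
    HasFDerivAt (fun y : EuclideanSpace ℝ (Fin n) => g ‖y‖)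
      ((deriv g ‖x‖ * ‖x‖⁻¹) • innerSL ℝ x) x := by
  have := hg.hasDerivAt.comp_hasFDerivAt x (hasFDerivAt_norm_of_ne_zero hx)
  rwa [smul_smul] at this

lemma partialDeriv_radial {g : ℝ → ℝ} (i : Fin n) (hx : x ≠ 0) (hg : DifferentiableAt ℝ g ‖x‖) :
    partialDeriv i (fun y => g ‖y‖) x = deriv g ‖x‖ * ‖x‖⁻¹ * x i := by
  simp [partialDeriv, (hasFDerivAt_radial hx hg).fderiv, EuclideanSpace.inner_single_right]

lemma euler_radial {g : ℝ → ℝ} (hx : x ≠ 0) (hg : DifferentiableAt ℝ g ‖x‖) :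
    euler (fun y => g ‖y‖) x = ‖x‖ * deriv g ‖x‖ := by
  have : ‖x‖ ≠ 0 := norm_ne_zero_iff.2 hx
  simp [euler, (hasFDerivAt_radial hx hg).fderiv]
  field_simp

lemma integral_mul_partialDeriv (i : Fin n) (hU : IsOpen U) (hG : ContDiffOn ℝ 1 G U)
    (hv : IsTestFunction U v) :
    ∫ x, G x * partialDeriv i v x = - ∫ x, partialDeriv i G x * v x := by
  have hG' : ContinuousOn (partialDeriv i G) U :=
    (hG.continuousOn_fderiv_of_isOpen hU le_rfl).clm_apply continuousOn_const
  refine integral_mul_fderiv_eq_neg_fderiv_mul_of_integrable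
    (hv.integrable_mul hU hG') ((hv.partialDeriv i).integrable_mul hU hG.continuousOn)
    (hv.integrable_mul hU hG.continuousOn) (fun x hx => ?_) fun x _ => hv.differentiableAt
  exact (hG.contDiffAt (hU.mem_nhds (hv.2.2 hx))).differentiableAt (by simp)

lemma contDiffOn_radial {m : ℕ∞ω} {g : ℝ → ℝ} (hg : ContDiffOn ℝ m g (Ioo 0 R)) :
    ContDiffOn ℝ m (fun x : EuclideanSpace ℝ (Fin n) => g ‖x‖) (puncturedBall n R) :=
  hg.comp (fun _ hx => (contDiffAt_norm ℝ hx.2).contDiffWithinAt)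
    fun _ hx => norm_mem_Ioo_of_mem_puncturedBall hx

lemma continuousOn_radial {g : ℝ → ℝ} (hg : ContinuousOn g (Ioo 0 R)) :
    ContinuousOn (fun x : EuclideanSpace ℝ (Fin n) => g ‖x‖) (puncturedBall n R) :=
  hg.comp continuous_norm.continuousOn fun _ hx => norm_mem_Ioo_of_mem_puncturedBall hx

lemma IsTestFunction.integrable_radial_mul {g : ℝ → ℝ} (hg : ContinuousOn g (Ioo 0 R))
    (hv : IsTestFunction (puncturedBall n R) v) : Integrable (fun x => g ‖x‖ * v x) :=
  hv.integrable_mul isOpen_puncturedBall (continuousOn_radial hg)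

/-- Integration by parts for the Euler operator against a radial weight. -/
lemma integral_radial_mul_euler {g : ℝ → ℝ} (hg : ContDiffOn ℝ 1 g (Ioo 0 R))
    (hv : IsTestFunction (puncturedBall n R) v) :
    ∫ x, g ‖x‖ * euler v x = - ∫ x, (‖x‖ * deriv g ‖x‖ + n * g ‖x‖) * v x := by
  have hgi (i : Fin n) : ContDiffOn ℝ 1 (fun x : EuclideanSpace ℝ (Fin n) => g ‖x‖ * x i)
      (puncturedBall n R) :=
    (contDiffOn_radial hg).mul ((contDiff_coord i).of_le (by simp)).contDiffOn
  have hd (i : Fin n) : ContinuousOn (partialDeriv i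
      (fun x : EuclideanSpace ℝ (Fin n) => g ‖x‖ * x i)) (puncturedBall n R) :=
    ((hgi i).continuousOn_fderiv_of_isOpen isOpen_puncturedBall le_rfl).clm_apply
      continuousOn_const
  -- The radial field `g ‖x‖ • x` has divergence `‖x‖ * deriv g ‖x‖ + n * g ‖x‖`; the rest is the
  -- divergence theorem, coordinate by coordinate.
  have h1 : ∀ x, g ‖x‖ * euler v x = ∑ i, (g ‖x‖ * x i) * partialDeriv i v x := by
    intro x
    rw [euler_eq_sum, Finset.mul_sum]
    exact Finset.sum_congr rfl fun i _ => by ring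
  simp_rw [h1]
  rw [integral_finsetSum _ fun i _ => (hv.partialDeriv i).integrable_mul isOpen_puncturedBall
    (hgi i).continuousOn]
  simp_rw [fun i => integral_mul_partialDeriv i isOpen_puncturedBall (hgi i) hv]
  rw [Finset.sum_neg_distrib, ← integral_finsetSum _ fun i _ =>
    hv.integrable_mul isOpen_puncturedBall (hd i)]
  congr 1
  refine integral_congr_ae (.of_forall fun x => ?_)
  by_cases hx : x ∈ puncturedBall n R
  · have hgd : DifferentiableAt ℝ g ‖x‖ :=
      (hg.contDiffAt (isOpen_Ioo.mem_nhds (norm_mem_Ioo_of_mem_puncturedBall hx))).differentiableAt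
        (by simp)
    have hx0 : ‖x‖ ≠ 0 := norm_ne_zero_iff.2 hx.2
    simp only
    simp_rw [fun i => partialDeriv_mul i (hasFDerivAt_radial hx.2 hgd).differentiableAt
      (differentiableAt_coord i), partialDeriv_radial _ hx.2 hgd, partialDeriv_coord]
    rw [← Finset.sum_mul, Finset.sum_add_distrib]
    congr 1
    have : ∑ i, deriv g ‖x‖ * ‖x‖⁻¹ * x i * x i = deriv g ‖x‖ * ‖x‖⁻¹ * ‖x‖ ^ 2 := by
      rw [EuclideanSpace.real_norm_sq_eq, Finset.mul_sum]
      exact Finset.sum_congr rfl fun i _ => by ring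
    rw [this]
    simp
    field_simp
    ring
  · simp [hv.eq_zero_of_notMem hx]

end TestFunctions

/-! ### Comparison of the Laplacian with its radial part -/

section Rellich

variable {n : ℕ} {R : ℝ} {u v : EuclideanSpace ℝ (Fin n) → ℝ} {x : EuclideanSpace ℝ (Fin n)}

lemma contDiffOn_inv_pow {m : ℕ∞ω} (k : ℕ) :
    ContDiffOn ℝ m (fun r : ℝ => (r ^ k)⁻¹) (Ioo 0 R) :=
  (contDiff_id.pow k).contDiffOn.inv fun _ hr => pow_ne_zero k hr.1.ne'

lemma hasDerivAt_inv_pow (k : ℕ) {r : ℝ} (hr : r ≠ 0) :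
    HasDerivAt (fun r : ℝ => (r ^ k)⁻¹) (-(k * (r ^ k)⁻¹ * r⁻¹)) r := by
  refine ((hasDerivAt_pow k r).fun_inv (pow_ne_zero k hr)).congr_deriv ?_
  -- The exponent `k - 1` in the derivative of `r ^ k` is truncated, so `k = 0` stands apart.
  rcases k with _ | k
  · simp
  · simp only [Nat.add_sub_cancel]
    field_simp
    ring

lemma integral_add_const_mul_add_const_mul {α : Type*} [MeasurableSpace α] {μ : Measure α}
    {f g h : α → ℝ} (hf : Integrable f μ) (hg : Integrable g μ) (hh : Integrable h μ) (a b : ℝ) :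
    ∫ x, (f x + a * g x + b * h x) ∂μ = ∫ x, f x ∂μ + a * ∫ x, g x ∂μ + b * ∫ x, h x ∂μ := by
  have h1 : Integrable (fun x => a * g x) μ := hg.const_mul a
  have h2 : Integrable (fun x => b * h x) μ := hh.const_mul b
  have h3 : Integrable (fun x => f x + a * g x) μ := hf.add h1
  rw [integral_add h3 h2, integral_add hf h1, integral_const_mul, integral_const_mul]

lemma IsTestFunction.integrable_inv_pow_mul (k : ℕ)
    (hv : IsTestFunction (puncturedBall n R) v) :
    Integrable (fun x => (‖x‖ ^ k)⁻¹ * v x) :=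
  hv.integrable_radial_mul (g := fun r => (r ^ k)⁻¹) (contDiffOn_inv_pow (m := 1) k).continuousOn

lemma IsTestFunction.inv_pow_mul (k : ℕ) (hv : IsTestFunction (puncturedBall n R) v) :
    IsTestFunction (puncturedBall n R) (fun x => (‖x‖ ^ k)⁻¹ * v x) :=
  hv.smooth_mul isOpen_puncturedBall
    (contDiffOn_radial (g := fun r => (r ^ k)⁻¹) (contDiffOn_inv_pow k))

lemma integral_inv_pow_mul_euler (k : ℕ) (hv : IsTestFunction (puncturedBall n R) v) :
    ∫ x, (‖x‖ ^ k)⁻¹ * euler v x = - ((n : ℝ) - k) * ∫ x, (‖x‖ ^ k)⁻¹ * v x := by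
  rw [integral_radial_mul_euler (g := fun r => (r ^ k)⁻¹) (contDiffOn_inv_pow k) hv, neg_mul,
    ← integral_const_mul]
  congr 1
  refine integral_congr_ae (.of_forall fun x => ?_)
  by_cases hx : x ∈ puncturedBall n R
  · have hx0 : ‖x‖ ≠ 0 := norm_ne_zero_iff.2 hx.2
    simp only [(hasDerivAt_inv_pow k hx0).deriv]
    field_simp
    ring
  · simp [hv.eq_zero_of_notMem hx]

/-- Since `v Ev = E(v²) / 2`, the cross term of a completed square becomes a multiple of its
zeroth-order term. -/
lemma integral_inv_pow_mul_mul_euler (k : ℕ) (hv : IsTestFunction (puncturedBall n R) v) :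
    ∫ x, (‖x‖ ^ k)⁻¹ * (v x * euler v x) =
      - (((n : ℝ) - k) / 2) * ∫ x, (‖x‖ ^ k)⁻¹ * v x ^ 2 := by
  have h := integral_inv_pow_mul_euler k (hv.mul hv)
  have h2 : ∀ x, (‖x‖ ^ k)⁻¹ * euler (fun y => v y * v y) x =
      2 * ((‖x‖ ^ k)⁻¹ * (v x * euler v x)) := fun x => by
    rw [euler_mul hv.differentiableAt hv.differentiableAt]; ring
  simp_rw [h2, integral_const_mul, ← sq] at h
  linarith

/-- The tangential part of the gradient of `u`. -/
noncomputable def tangential (u : EuclideanSpace ℝ (Fin n) → ℝ) (i : Fin n)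
    (x : EuclideanSpace ℝ (Fin n)) : ℝ :=
  partialDeriv i u x - x i * ((‖x‖ ^ 2)⁻¹ * euler u x)

lemma IsTestFunction.tangential (hu : IsTestFunction (puncturedBall n R) u) (i : Fin n) :
    IsTestFunction (puncturedBall n R) (tangential u i) :=
  (hu.partialDeriv i).sub ((hu.euler.inv_pow_mul 2).coord_mul i)

lemma sum_coord_mul_tangential (u : EuclideanSpace ℝ (Fin n) → ℝ)
    (x : EuclideanSpace ℝ (Fin n)) : ∑ i, x i * tangential u i x = 0 := by
  have : ∀ i, x i * tangential u i x =
      x i * partialDeriv i u x - x i ^ 2 * ((‖x‖ ^ 2)⁻¹ * euler u x) := fun i => by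
    simp only [tangential]; ring
  simp_rw [this]
  rw [Finset.sum_sub_distrib, ← euler_eq_sum, ← Finset.sum_mul, ← EuclideanSpace.real_norm_sq_eq]
  rcases eq_or_ne x 0 with rfl | hx
  · simp [euler]
  · have : ‖x‖ ≠ 0 := norm_ne_zero_iff.2 hx
    field_simp
    ring

lemma differentiableAt_inv_pow_norm (k : ℕ) (hx : x ≠ 0) :
    DifferentiableAt ℝ (fun y : EuclideanSpace ℝ (Fin n) => (‖y‖ ^ k)⁻¹) x :=
  (hasFDerivAt_radial (g := fun r => (r ^ k)⁻¹) hx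
    (hasDerivAt_inv_pow k (norm_ne_zero_iff.2 hx)).differentiableAt).differentiableAt

lemma euler_inv_sq_norm (hx : x ≠ 0) :
    euler (fun y : EuclideanSpace ℝ (Fin n) => (‖y‖ ^ 2)⁻¹) x = -2 * (‖x‖ ^ 2)⁻¹ := by
  have hx0 : ‖x‖ ≠ 0 := norm_ne_zero_iff.2 hx
  have h := hasDerivAt_inv_pow 2 hx0
  rw [euler_radial (g := fun r => (r ^ 2)⁻¹) hx h.differentiableAt, h.deriv]
  field_simp
  simp

lemma partialDeriv_inv_sq_norm (i : Fin n) (hx : x ≠ 0) :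
    partialDeriv i (fun y : EuclideanSpace ℝ (Fin n) => (‖y‖ ^ 2)⁻¹) x =
      -2 * (‖x‖ ^ 2)⁻¹ ^ 2 * x i := by
  have hx0 : ‖x‖ ≠ 0 := norm_ne_zero_iff.2 hx
  have h := hasDerivAt_inv_pow 2 hx0
  rw [partialDeriv_radial (g := fun r => (r ^ 2)⁻¹) i hx h.differentiableAt, h.deriv]
  field_simp
  push_cast
  ring

/-- Both `∂_i` and multiplication by `x_i |x|⁻²` lower homogeneity by one, hence obey the same
commutation rule with `E`. -/
lemma tangential_euler (hu : IsTestFunction (puncturedBall n R) u) (i : Fin n) :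
    tangential (euler u) i x = euler (tangential u i) x + tangential u i x := by
  by_cases hx : x ∈ puncturedBall n R
  · have hρ := differentiableAt_inv_pow_norm 2 hx.2
    have h1 : euler (tangential u i) x = euler (partialDeriv i u) x -
        (x i * ((‖x‖ ^ 2)⁻¹ * euler (euler u) x + -2 * (‖x‖ ^ 2)⁻¹ * euler u x) +
          x i * ((‖x‖ ^ 2)⁻¹ * euler u x)) := by
      have h2 : euler (tangential u i) x = euler (partialDeriv i u) x -
          euler (fun y => y i * ((‖y‖ ^ 2)⁻¹ * euler u y)) x :=
        euler_sub (hu.partialDeriv i).differentiableAt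
          ((hu.euler.inv_pow_mul 2).coord_mul i).differentiableAt
      rw [h2, euler_mul (differentiableAt_coord i) (hu.euler.inv_pow_mul 2).differentiableAt,
        euler_mul hρ hu.euler.differentiableAt, euler_inv_sq_norm hx.2, euler_coord]
    rw [h1]
    simp only [tangential, partialDeriv_euler i hu]
    ring
  · rw [(hu.euler.tangential i).eq_zero_of_notMem hx,
      (hu.tangential i).euler.eq_zero_of_notMem hx, (hu.tangential i).eq_zero_of_notMem hx, add_zero]

/-- The radial part `u_rr + (n - 1) / r * u_r` of the Laplacian. -/
noncomputable def radialLaplacian (u : EuclideanSpace ℝ (Fin n) → ℝ)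
    (x : EuclideanSpace ℝ (Fin n)) : ℝ :=
  (‖x‖ ^ 2)⁻¹ * (euler (euler u) x + ((n : ℝ) - 2) * euler u x)

lemma IsTestFunction.radialLaplacian (hu : IsTestFunction (puncturedBall n R) u) :
    IsTestFunction (puncturedBall n R) (radialLaplacian u) :=
  (hu.euler.euler.add (hu.euler.const_mul ((n : ℝ) - 2))).inv_pow_mul 2

/-- The gradient is its tangential part plus `x |x|⁻² Eu`, and the divergence of the latter is the
radial Laplacian. -/
lemma sum_partialDeriv_tangential (hu : IsTestFunction (puncturedBall n R) u) :
    ∑ i, partialDeriv i (tangential u i) x =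
      (∑ i, partialDeriv i (partialDeriv i u) x) - radialLaplacian u x := by
  by_cases hx : x ∈ puncturedBall n R
  · have h1 : ∀ i, partialDeriv i (tangential u i) x = partialDeriv i (partialDeriv i u) x -
        (x i * partialDeriv i (fun y => (‖y‖ ^ 2)⁻¹ * euler u y) x +
          (‖x‖ ^ 2)⁻¹ * euler u x) := by
      intro i
      have h2 : partialDeriv i (tangential u i) x = partialDeriv i (partialDeriv i u) x -
          partialDeriv i (fun y => y i * ((‖y‖ ^ 2)⁻¹ * euler u y)) x :=
        partialDeriv_sub i (hu.partialDeriv i).differentiableAt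
          ((hu.euler.inv_pow_mul 2).coord_mul i).differentiableAt
      rw [h2, partialDeriv_mul i (differentiableAt_coord i)
        (hu.euler.inv_pow_mul 2).differentiableAt, partialDeriv_coord]
      simp
    simp_rw [h1]
    rw [Finset.sum_sub_distrib, Finset.sum_add_distrib, ← euler_eq_sum,
      euler_mul (differentiableAt_inv_pow_norm 2 hx.2) hu.euler.differentiableAt,
      euler_inv_sq_norm hx.2]
    simp only [radialLaplacian, Finset.sum_const, Finset.card_univ, Fintype.card_fin, nsmul_eq_mul]
    ring
  · simp [((hu.tangential _).partialDeriv _).eq_zero_of_notMem hx,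
      ((hu.partialDeriv _).partialDeriv _).eq_zero_of_notMem hx,
      hu.radialLaplacian.eq_zero_of_notMem hx]

lemma sum_tangential_mul_partialDeriv (u v : EuclideanSpace ℝ (Fin n) → ℝ) :
    ∑ i, tangential u i x * partialDeriv i v x = ∑ i, tangential u i x * tangential v i x := by
  have : ∀ i, tangential u i x * partialDeriv i v x = tangential u i x * tangential v i x +
      (x i * tangential u i x) * ((‖x‖ ^ 2)⁻¹ * euler v x) := fun i => by
    simp only [tangential]; ring
  simp_rw [this]
  rw [Finset.sum_add_distrib, ← Finset.sum_mul, sum_coord_mul_tangential]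
  simp

/-- Terms along `x` drop out by orthogonality. Passing the tangential gradient through `E` turns `E`
into `E + 1`, and `(E+1)² + (n-2)(E+1) = E² + nE + (n-1)`. -/
lemma sum_partialDeriv_radialLaplacian_mul_tangential
    (hu : IsTestFunction (puncturedBall n R) u) :
    ∑ i, partialDeriv i (radialLaplacian u) x * tangential u i x =
      ∑ i, (‖x‖ ^ 2)⁻¹ * (tangential u i x * (euler (euler (tangential u i)) x +
        n * euler (tangential u i) x + ((n : ℝ) - 1) * tangential u i x)) := by
  by_cases hx : x ∈ puncturedBall n R
  · have hw := hu.euler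
    have hA := hw.euler.add (hw.const_mul ((n : ℝ) - 2))
    have h1 : ∀ i, partialDeriv i (radialLaplacian u) x * tangential u i x =
        (‖x‖ ^ 2)⁻¹ * (tangential u i x * partialDeriv i (euler (euler u)) x) +
        (‖x‖ ^ 2)⁻¹ * ((n : ℝ) - 2) * (tangential u i x * partialDeriv i (euler u) x) +
        (-2 * (‖x‖ ^ 2)⁻¹ ^ 2 * (euler (euler u) x + ((n : ℝ) - 2) * euler u x)) *
          (x i * tangential u i x) := by
      intro i
      have h2 : partialDeriv i (radialLaplacian u) x = (‖x‖ ^ 2)⁻¹ *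
          (partialDeriv i (euler (euler u)) x + ((n : ℝ) - 2) * partialDeriv i (euler u) x) +
          -2 * (‖x‖ ^ 2)⁻¹ ^ 2 * x i * (euler (euler u) x + ((n : ℝ) - 2) * euler u x) := by
        have h3 : partialDeriv i (radialLaplacian u) x = _ :=
          partialDeriv_mul i (differentiableAt_inv_pow_norm 2 hx.2) hA.differentiableAt
        rw [h3, partialDeriv_add i hw.euler.differentiableAt
          (hw.const_mul ((n : ℝ) - 2)).differentiableAt, partialDeriv_const_mul i _
          hw.differentiableAt, partialDeriv_inv_sq_norm i hx.2]
      rw [h2]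
      ring
    have h4 : ∀ i, tangential (euler (euler u)) i x = euler (euler (tangential u i)) x +
        2 * euler (tangential u i) x + tangential u i x := by
      intro i
      have h5 : tangential (euler u) i = fun y => euler (tangential u i) y + tangential u i y := by
        ext y; exact tangential_euler hu i
      rw [tangential_euler hw, h5, euler_add (hu.tangential i).euler.differentiableAt
        (hu.tangential i).differentiableAt]
      ring
    simp_rw [h1]
    rw [Finset.sum_add_distrib, Finset.sum_add_distrib, ← Finset.mul_sum, ← Finset.mul_sum,
      ← Finset.mul_sum, sum_coord_mul_tangential, sum_tangential_mul_partialDeriv,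
      sum_tangential_mul_partialDeriv, mul_zero, add_zero, Finset.mul_sum, Finset.mul_sum,
      ← Finset.sum_add_distrib]
    refine Finset.sum_congr rfl fun i _ => ?_
    rw [h4, tangential_euler hu]
    ring
  · simp [(hu.tangential _).eq_zero_of_notMem hx]

/-- Replace `v E²v` by `E(v Ev) - (Ev)²` and complete the square to `-(Ev + v)²`. Integration by
parts leaves `(4 - n) ∫ |x|⁻² v²`, whose sign is where `n ≥ 4` enters. -/
lemma integral_inv_sq_mul_euler_euler_le (hn : 4 ≤ n)
    (hv : IsTestFunction (puncturedBall n R) v) :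
    ∫ x, (‖x‖ ^ 2)⁻¹ * (v x * (euler (euler v) x + n * euler v x + ((n : ℝ) - 1) * v x)) ≤ 0 := by
  have e1 := integral_inv_pow_mul_euler 2 (hv.mul hv.euler)
  have e2 := integral_inv_pow_mul_mul_euler 2 hv
  have i0 : Integrable fun x => (‖x‖ ^ 2)⁻¹ * v x ^ 2 := by
    simpa [sq] using (hv.mul hv).integrable_inv_pow_mul 2
  have i1 := (hv.mul hv.euler).integrable_inv_pow_mul 2
  have i2 := (hv.mul hv.euler).euler.integrable_inv_pow_mul 2
  have i3 : Integrable fun x => (‖x‖ ^ 2)⁻¹ * (euler v x + v x) ^ 2 := by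
    simpa [sq] using ((hv.euler.add hv).mul (hv.euler.add hv)).integrable_inv_pow_mul 2
  have h : ∀ x, (‖x‖ ^ 2)⁻¹ *
      (v x * (euler (euler v) x + n * euler v x + ((n : ℝ) - 1) * v x)) =
      (‖x‖ ^ 2)⁻¹ * euler (fun y => v y * euler v y) x +
        ((n : ℝ) + 2) * ((‖x‖ ^ 2)⁻¹ * (v x * euler v x)) + n * ((‖x‖ ^ 2)⁻¹ * v x ^ 2) -
        (‖x‖ ^ 2)⁻¹ * (euler v x + v x) ^ 2 := by
    intro x
    rw [euler_mul hv.differentiableAt hv.euler.differentiableAt]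
    ring
  simp_rw [h]
  rw [integral_sub (by exact (i2.add (i1.const_mul _)).add (i0.const_mul _)) i3,
    integral_add_const_mul_add_const_mul i2 i1 i0, e1, e2]
  have p0 : 0 ≤ ∫ x, (‖x‖ ^ 2)⁻¹ * v x ^ 2 := integral_nonneg fun x => by positivity
  have p3 : 0 ≤ ∫ x, (‖x‖ ^ 2)⁻¹ * (euler v x + v x) ^ 2 := integral_nonneg fun x => by positivity
  have hn' : (4 : ℝ) ≤ n := by exact_mod_cast hn
  push_cast
  nlinarith [mul_nonneg (sub_nonneg.2 hn') p0]

/-- In the square of `A + B` the term `B²` is discarded. For `A B`, the divergence is moved onto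
`A`, and every component of the tangential gradient then contributes with the right sign. -/
lemma integral_radialLaplacian_sq_le (hn : 4 ≤ n) (hu : IsTestFunction (puncturedBall n R) u) :
    ∫ x, radialLaplacian u x ^ 2 ≤ ∫ x, (∑ i, partialDeriv i (partialDeriv i u) x) ^ 2 := by
  set B : EuclideanSpace ℝ (Fin n) → ℝ := fun x => ∑ i, partialDeriv i (tangential u i) x with hB
  have tA := hu.radialLaplacian
  have tB : IsTestFunction (puncturedBall n R) B :=
    IsTestFunction.sum _ fun i _ => (hu.tangential i).partialDeriv i
  have hΔ : ∀ x, ∑ i, partialDeriv i (partialDeriv i u) x = radialLaplacian u x + B x := fun x => by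
    simp only [hB]
    rw [sum_partialDeriv_tangential hu]
    ring
  have iAA : Integrable fun x => radialLaplacian u x ^ 2 := by
    simpa [sq] using (tA.mul tA).integrable
  have iBB : Integrable fun x => B x ^ 2 := by simpa [sq] using (tB.mul tB).integrable
  have iAB := (tA.mul tB).integrable
  have key : 0 ≤ ∫ x, radialLaplacian u x * B x := by
    have e1 : ∫ x, radialLaplacian u x * B x =
        ∑ i, ∫ x, radialLaplacian u x * partialDeriv i (tangential u i) x := by
      simp_rw [hB, Finset.mul_sum]
      exact integral_finsetSum _ fun i _ => (tA.mul ((hu.tangential i).partialDeriv i)).integrable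
    have e2 : ∑ i, ∫ x, radialLaplacian u x * partialDeriv i (tangential u i) x =
        - ∫ x, ∑ i, partialDeriv i (radialLaplacian u) x * tangential u i x := by
      rw [integral_finsetSum _ fun i _ => ((tA.partialDeriv i).mul (hu.tangential i)).integrable,
        ← Finset.sum_neg_distrib]
      exact Finset.sum_congr rfl fun i _ => integral_mul_partialDeriv i isOpen_univ
        (tA.contDiff.of_le (by simp)).contDiffOn ((hu.tangential i).mono (subset_univ _))
    rw [e1, e2]
    simp_rw [sum_partialDeriv_radialLaplacian_mul_tangential hu]
    rw [integral_finsetSum _ fun i _ => ?_]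
    · refine neg_nonneg.2 (Finset.sum_nonpos fun i _ =>
        integral_inv_sq_mul_euler_euler_le hn (hu.tangential i))
    · have ht := hu.tangential i
      exact (ht.mul ((ht.euler.euler.add (ht.euler.const_mul n)).add
        (ht.const_mul ((n : ℝ) - 1)))).integrable_inv_pow_mul 2
  have h : ∀ x, (∑ i, partialDeriv i (partialDeriv i u) x) ^ 2 =
      radialLaplacian u x ^ 2 + 2 * (radialLaplacian u x * B x) + 1 * B x ^ 2 := fun x => by
    rw [hΔ]; ring
  simp_rw [h]
  rw [integral_add_const_mul_add_const_mul iAA iAB iBB]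
  have : 0 ≤ ∫ x, B x ^ 2 := integral_nonneg fun x => sq_nonneg _
  linarith

/-- Grouping `E² + (n-2)E` as `(E² - E) + (n-1)E` isolates the expression `Ev - v`, with `v = Eu`,
on which the weighted Hardy inequality acts. -/
lemma integral_radialLaplacian_sq (hu : IsTestFunction (puncturedBall n R) u) :
    ∫ x, radialLaplacian u x ^ 2 =
      (∫ x, (‖x‖ ^ 4)⁻¹ * (euler (euler u) x - euler u x) ^ 2) +
        ((n : ℝ) - 1) * ∫ x, (‖x‖ ^ 4)⁻¹ * euler u x ^ 2 := by
  have hw := hu.euler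
  have e := integral_inv_pow_mul_mul_euler 4 hw
  have i0 : Integrable fun x => (‖x‖ ^ 4)⁻¹ * euler u x ^ 2 := by
    simpa [sq] using (hw.mul hw).integrable_inv_pow_mul 4
  have i1 := (hw.mul hw.euler).integrable_inv_pow_mul 4
  have i2 : Integrable fun x => (‖x‖ ^ 4)⁻¹ * (euler (euler u) x - euler u x) ^ 2 := by
    simpa [sq] using ((hw.euler.sub hw).mul (hw.euler.sub hw)).integrable_inv_pow_mul 4
  have h : ∀ x, radialLaplacian u x ^ 2 = (‖x‖ ^ 4)⁻¹ * (euler (euler u) x - euler u x) ^ 2 +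
      2 * ((n : ℝ) - 1) * ((‖x‖ ^ 4)⁻¹ * (euler u x * euler (euler u) x)) +
      ((n : ℝ) - 1) * ((n : ℝ) - 3) * ((‖x‖ ^ 4)⁻¹ * euler u x ^ 2) := fun x => by
    have : (‖x‖ ^ 4)⁻¹ = (‖x‖ ^ 2)⁻¹ ^ 2 := by rw [inv_pow, ← pow_mul]
    simp only [radialLaplacian, this]
    ring
  simp_rw [h]
  rw [integral_add_const_mul_add_const_mul i2 i1 i0, e]
  push_cast
  ring

end Rellich

/-! ### Weighted Hardy inequalities by completing squares -/

section Weights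

variable {n : ℕ} {R : ℝ} {P : ℝ → ℝ} {u v : EuclideanSpace ℝ (Fin n) → ℝ}
  {x : EuclideanSpace ℝ (Fin n)}

lemma inv_sq_norm_mul_euler_sq_le (v : EuclideanSpace ℝ (Fin n) → ℝ)
    (x : EuclideanSpace ℝ (Fin n)) :
    (‖x‖ ^ 2)⁻¹ * euler v x ^ 2 ≤ ∑ i, partialDeriv i v x ^ 2 := by
  rcases eq_or_ne x 0 with rfl | hx
  · simpa [euler] using Finset.sum_nonneg fun i _ => sq_nonneg (partialDeriv i v 0)
  · have hx0 : 0 < ‖x‖ ^ 2 := by positivity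
    rw [inv_mul_le_iff₀ hx0, euler_eq_sum, EuclideanSpace.real_norm_sq_eq]
    exact Finset.sum_mul_sq_le_sq_mul_sq _ _ _

lemma integral_radial_mul_mul_euler {g : ℝ → ℝ} (hg : ContDiffOn ℝ 1 g (Ioo 0 R))
    (hv : IsTestFunction (puncturedBall n R) v) :
    2 * ∫ x, g ‖x‖ * (v x * euler v x) =
      - ∫ x, (‖x‖ * deriv g ‖x‖ + n * g ‖x‖) * v x ^ 2 := by
  have h := integral_radial_mul_euler hg (hv.mul hv)
  have h2 : ∀ x, g ‖x‖ * euler (fun y => v y * v y) x =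
      2 * (g ‖x‖ * (v x * euler v x)) := fun x => by
    rw [euler_mul hv.differentiableAt hv.differentiableAt]; ring
  simp_rw [h2, integral_const_mul, ← sq] at h
  exact h

/-- The improved Hardy inequality with constant one, away from the origin. -/
lemma IsHIPotential.integral_le_integral_euler_sq (hP : IsHIPotential P R)
    (hv : IsTestFunction (puncturedBall n R) v) :
    ∫ x, (((n : ℝ) - 2) ^ 2 / 4 * (‖x‖ ^ 2)⁻¹ + P ‖x‖) * v x ^ 2 ≤
      ∫ x, (‖x‖ ^ 2)⁻¹ * euler v x ^ 2 := by
  obtain ⟨y, hy, hy2⟩ := hP.exists_pos_solution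
  have hy' : ContDiffOn ℝ 1 (deriv y) (Ioo 0 R) :=
    hy.deriv_of_isOpen isOpen_Ioo (by norm_num)
  -- This is the logarithmic derivative `r φ'/φ` of the ground state `φ = r^(-(n-2)/2) y(r)`. The
  -- square `(Ev - qv)²` vanishes for `v = φ(|x|)`.
  have hq : ContDiffOn ℝ 1 (fun r => -((n : ℝ) - 2) / 2 + r * deriv y r / y r) (Ioo 0 R) :=
    contDiffOn_const.add ((contDiffOn_id.mul hy').div (hy.of_le (by norm_num))
      fun r hr => (hy2 r hr).1.ne')
  set q : ℝ → ℝ := fun r => -((n : ℝ) - 2) / 2 + r * deriv y r / y r with hqdef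
  have hg : ContDiffOn ℝ 1 (fun r => (r ^ 2)⁻¹ * q r) (Ioo 0 R) := (contDiffOn_inv_pow 2).mul hq
  have hq2 : ContinuousOn (fun r => (r ^ 2)⁻¹ * q r ^ 2) (Ioo 0 R) :=
    (contDiffOn_inv_pow (m := 1) 2).continuousOn.mul (hq.continuousOn.pow 2)
  have ibp := integral_radial_mul_mul_euler hg hv
  have hWc : ContinuousOn (fun r => ((n : ℝ) - 2) ^ 2 / 4 * (r ^ 2)⁻¹ + P r) (Ioo 0 R) :=
    (continuousOn_const.mul (contDiffOn_inv_pow (m := 1) 2).continuousOn).add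
      hP.contDiffOn.continuousOn
  have hvv : ∀ x, v x ^ 2 = v x * v x := fun x => sq _
  have iW : Integrable fun x => (((n : ℝ) - 2) ^ 2 / 4 * (‖x‖ ^ 2)⁻¹ + P ‖x‖) * v x ^ 2 := by
    simp_rw [hvv]
    exact (hv.mul hv).integrable_radial_mul hWc
  have i0 : Integrable fun x => (‖x‖ ^ 2)⁻¹ * euler v x ^ 2 := by
    simpa [sq] using (hv.euler.mul hv.euler).integrable_inv_pow_mul 2
  have i1 : Integrable fun x => ((‖x‖ ^ 2)⁻¹ * q ‖x‖) * (v x * euler v x) :=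
    (hv.mul hv.euler).integrable_radial_mul hg.continuousOn
  have i2 : Integrable fun x => ((‖x‖ ^ 2)⁻¹ * q ‖x‖ ^ 2) * v x ^ 2 := by
    simp_rw [hvv]
    exact (hv.mul hv).integrable_radial_mul hq2
  -- The equation for `y` becomes the Riccati equation `r q' + (n-2) q + q² = -((n-2)²/4 + r² P)`.
  have hkey : ∀ x, (‖x‖ * deriv (fun r => (r ^ 2)⁻¹ * q r) ‖x‖ + n * ((‖x‖ ^ 2)⁻¹ * q ‖x‖)) *
      v x ^ 2 = -((((n : ℝ) - 2) ^ 2 / 4 * (‖x‖ ^ 2)⁻¹ + P ‖x‖) * v x ^ 2 +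
        ((‖x‖ ^ 2)⁻¹ * q ‖x‖ ^ 2) * v x ^ 2) := by
    intro x
    by_cases hx : x ∈ puncturedBall n R
    · have hr := norm_mem_Ioo_of_mem_puncturedBall hx
      set r := ‖x‖
      have hr0 : r ≠ 0 := hr.1.ne'
      have hnhds := isOpen_Ioo.mem_nhds hr
      have dy : HasDerivAt y (deriv y r) r :=
        ((hy.contDiffAt hnhds).differentiableAt (by norm_num)).hasDerivAt
      have dy' : HasDerivAt (deriv y) (deriv (deriv y) r) r :=
        ((hy'.contDiffAt hnhds).differentiableAt (by norm_num)).hasDerivAt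
      obtain ⟨hpos, hode⟩ := hy2 r hr
      have dq := (((hasDerivAt_id r).mul dy').div dy hpos.ne').const_add (-((n : ℝ) - 2) / 2)
      have dg : HasDerivAt (fun r => (r ^ 2)⁻¹ * q r) _ r := (hasDerivAt_inv_pow 2 hr0).mul dq
      have hode' : deriv (deriv y) r = -(1 / r * deriv y r + P r * y r) := by linarith
      rw [dg.deriv, hode']
      simp only [hqdef, id, Pi.mul_apply]
      rw [← add_mul, ← neg_mul]
      have := hpos.ne'
      field_simp
      push_cast
      ring
    · simp [hv.eq_zero_of_notMem hx]
  simp_rw [hkey] at ibp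
  rw [integral_neg, neg_neg, integral_add iW i2] at ibp
  have hnn : 0 ≤ ∫ x, (‖x‖ ^ 2)⁻¹ * (euler v x - q ‖x‖ * v x) ^ 2 :=
    integral_nonneg fun x => by positivity
  have hexp : ∀ x, (‖x‖ ^ 2)⁻¹ * (euler v x - q ‖x‖ * v x) ^ 2 = (‖x‖ ^ 2)⁻¹ * euler v x ^ 2 +
      (-2) * (((‖x‖ ^ 2)⁻¹ * q ‖x‖) * (v x * euler v x)) +
      1 * (((‖x‖ ^ 2)⁻¹ * q ‖x‖ ^ 2) * v x ^ 2) := fun x => by ring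
  simp_rw [hexp] at hnn
  rw [integral_add_const_mul_add_const_mul i0 i1 i2] at hnn
  linarith

/-- A one-dimensional weighted Hardy inequality along rays. -/
lemma integral_potential_mul_sq_le {lam : ℝ} {f : ℝ → ℝ} (hlam : lam < (n : ℝ) - 2)
    (hP : ContDiffOn ℝ 1 P (Ioo 0 R)) (hPpos : ∀ r ∈ Ioo 0 R, 0 < P r)
    (hPf : ∀ r ∈ Ioo 0 R, deriv P r / P r = -lam / r + f r)
    (hf : ∀ r ∈ Ioo 0 R, 0 ≤ f r) (hv : IsTestFunction (puncturedBall n R) v) :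
    ((n : ℝ) - lam - 2) ^ 2 / 4 * ∫ x, (P ‖x‖ * (‖x‖ ^ 2)⁻¹) * v x ^ 2 ≤
      ∫ x, (P ‖x‖ * (‖x‖ ^ 2)⁻¹) * euler v x ^ 2 := by
  have hg : ContDiffOn ℝ 1 (fun r => P r * (r ^ 2)⁻¹) (Ioo 0 R) := hP.mul (contDiffOn_inv_pow 2)
  have hg' : ContinuousOn (fun r => r * deriv (fun r => P r * (r ^ 2)⁻¹) r +
      n * (P r * (r ^ 2)⁻¹)) (Ioo 0 R) :=
    (continuousOn_id.mul (hg.continuousOn_deriv_of_isOpen isOpen_Ioo le_rfl)).add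
      (continuousOn_const.mul hg.continuousOn)
  have ibp := integral_radial_mul_mul_euler hg hv
  have i0 : Integrable fun x => (P ‖x‖ * (‖x‖ ^ 2)⁻¹) * v x ^ 2 := by
    simpa [sq] using (hv.mul hv).integrable_radial_mul hg.continuousOn
  have i1 : Integrable fun x => (P ‖x‖ * (‖x‖ ^ 2)⁻¹) * (v x * euler v x) :=
    (hv.mul hv.euler).integrable_radial_mul hg.continuousOn
  have i2 : Integrable fun x => (P ‖x‖ * (‖x‖ ^ 2)⁻¹) * euler v x ^ 2 := by
    simpa [sq] using (hv.euler.mul hv.euler).integrable_radial_mul hg.continuousOn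
  -- For `w = P / r²` the condition on `P'/P` says `r w' + n w = (n - λ - 2 + r f) w`; the part with
  -- `f ≥ 0` is dropped.
  have hle : ((n : ℝ) - lam - 2) * ∫ x, (P ‖x‖ * (‖x‖ ^ 2)⁻¹) * v x ^ 2 ≤
      ∫ x, (‖x‖ * deriv (fun r => P r * (r ^ 2)⁻¹) ‖x‖ + n * (P ‖x‖ * (‖x‖ ^ 2)⁻¹)) *
        v x ^ 2 := by
    rw [← integral_const_mul]
    refine integral_mono (i0.const_mul _) ?_ fun x => ?_
    · simpa [sq] using (hv.mul hv).integrable_radial_mul hg'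
    by_cases hx : x ∈ puncturedBall n R
    · have hr := norm_mem_Ioo_of_mem_puncturedBall hx
      simp only
      set r := ‖x‖
      have hr0 : 0 < r := hr.1
      have dP : HasDerivAt P (deriv P r) r :=
        ((hP.contDiffAt (isOpen_Ioo.mem_nhds hr)).differentiableAt (by norm_num)).hasDerivAt
      have dg : HasDerivAt (fun r => P r * (r ^ 2)⁻¹) _ r :=
        dP.mul (hasDerivAt_inv_pow 2 hr0.ne')
      have hP' : deriv P r = (-lam / r + f r) * P r := by
        rw [← hPf r hr, div_mul_cancel₀ _ (hPpos r hr).ne']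
      rw [dg.deriv, hP', ← mul_assoc]
      refine mul_le_mul_of_nonneg_right ?_ (sq_nonneg _)
      have : r * ((-lam / r + f r) * P r * (r ^ 2)⁻¹ +
          P r * -(((2 : ℕ) : ℝ) * (r ^ 2)⁻¹ * r⁻¹)) + n * (P r * (r ^ 2)⁻¹) =
          ((n : ℝ) - lam - 2) * (P r * (r ^ 2)⁻¹) + f r * P r * r⁻¹ := by
        field_simp
        push_cast
        ring
      rw [this]
      have := mul_nonneg (mul_nonneg (hf r hr) (hPpos r hr).le) (inv_nonneg.2 hr0.le)
      linarith
    · simp [hv.eq_zero_of_notMem hx]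
  -- By `ibp` and `hle`, the square `(Ev + cv)²` gives the lower bound `2c · c - c²`, optimal for
  -- this `c`. Multiplying `hle` by `c` keeps its direction because `λ < n - 2`.
  set c : ℝ := ((n : ℝ) - lam - 2) / 2 with hc
  have hcpos : 0 < c := by rw [hc]; linarith
  have hnn : 0 ≤ ∫ x, (P ‖x‖ * (‖x‖ ^ 2)⁻¹) * (euler v x + c * v x) ^ 2 := by
    refine integral_nonneg fun x => ?_
    by_cases hx : x ∈ puncturedBall n R
    · have := hPpos _ (norm_mem_Ioo_of_mem_puncturedBall hx)
      simp only [Pi.zero_apply]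
      positivity
    · simp [hv.eq_zero_of_notMem hx, hv.euler.eq_zero_of_notMem hx]
  have hexp : ∀ x, (P ‖x‖ * (‖x‖ ^ 2)⁻¹) * (euler v x + c * v x) ^ 2 =
      (P ‖x‖ * (‖x‖ ^ 2)⁻¹) * euler v x ^ 2 +
      (2 * c) * ((P ‖x‖ * (‖x‖ ^ 2)⁻¹) * (v x * euler v x)) +
      c ^ 2 * ((P ‖x‖ * (‖x‖ ^ 2)⁻¹) * v x ^ 2) := fun x => by ring
  simp_rw [hexp] at hnn
  rw [integral_add_const_mul_add_const_mul i2 i1 i0] at hnn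
  have h2c : (n : ℝ) - lam - 2 = 2 * c := by rw [hc]; ring
  rw [h2c] at hle ⊢
  nlinarith [mul_le_mul_of_nonneg_left hle hcpos.le]

end Weights

/-! ### Reduction to rays in polar coordinates -/

section Polar

variable {n : ℕ}

/-- By Fubini it suffices to have a nonnegative integral on each ray. The hypothesis gives that
integral times the area of the unit sphere, which is positive and finite. -/
lemma integral_nonneg_of_forall_radial [NeZero n] {F : EuclideanSpace ℝ (Fin n) → ℝ}
    (hF : Integrable F)
    (h : ∀ ξ : EuclideanSpace ℝ (Fin n), ‖ξ‖ = 1 → 0 ≤ ∫ x : EuclideanSpace ℝ (Fin n), F (‖x‖ • ξ)) :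
    0 ≤ ∫ x, F x := by
  have hnt : Nontrivial (EuclideanSpace ℝ (Fin n)) := by
    refine ⟨⟨EuclideanSpace.single 0 1, 0, ?_⟩⟩
    simp
  set μ : Measure (EuclideanSpace ℝ (Fin n)) := volume
  have hmp := μ.measurePreserving_homeomorphUnitSphereProd
  set e := homeomorphUnitSphereProd (EuclideanSpace ℝ (Fin n))
  have h1 : ∫ x, F x = ∫ p, F (e.symm p).1
      ∂(μ.toSphere.prod (.volumeIoiPow (Module.finrank ℝ (EuclideanSpace ℝ (Fin n)) - 1))) := by
    rw [← hmp.integral_comp (Homeomorph.measurableEmbedding _)]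
    simp only [Homeomorph.symm_apply_apply]
    rw [integral_subtype_comap (measurableSet_singleton _).compl F, restrict_compl_singleton]
  have hint : Integrable (fun p => F (e.symm p).1)
      (μ.toSphere.prod (.volumeIoiPow (Module.finrank ℝ (EuclideanSpace ℝ (Fin n)) - 1))) := by
    rw [← hmp.integrable_comp_emb (Homeomorph.measurableEmbedding _)]
    have : (fun p => F (e.symm p).1) ∘ e = F ∘ Subtype.val := by ext x; simp
    rw [this, ← integrableOn_iff_comap_subtypeVal (measurableSet_singleton _).compl]
    exact hF.integrableOn
  rw [h1, integral_prod _ hint]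
  refine integral_nonneg fun ξ => ?_
  have hξ : ‖(ξ : EuclideanSpace ℝ (Fin n))‖ = 1 := by simp
  have h2 := h ξ hξ
  have h3 : ∫ x : EuclideanSpace ℝ (Fin n), F (‖x‖ • (ξ : EuclideanSpace ℝ (Fin n))) =
      μ.toSphere.real univ * ∫ r, F (e.symm (ξ, r)).1
        ∂(.volumeIoiPow (Module.finrank ℝ (EuclideanSpace ℝ (Fin n)) - 1)) := by
    have h4 := integral_fun_snd (μ := μ.toSphere)
      (ν := .volumeIoiPow (Module.finrank ℝ (EuclideanSpace ℝ (Fin n)) - 1))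
      (fun r : Ioi (0 : ℝ) => F (e.symm (ξ, r)).1)
    rw [smul_eq_mul] at h4
    rw [← h4, ← hmp.integral_comp (Homeomorph.measurableEmbedding _)]
    have h5 := integral_subtype_comap (μ := μ) (measurableSet_singleton (0 : EuclideanSpace ℝ (Fin n))).compl
      (fun x => F (‖x‖ • (ξ : EuclideanSpace ℝ (Fin n))))
    rw [restrict_compl_singleton] at h5
    rw [← h5]
    simp [e]
  rw [h3] at h2
  refine nonneg_of_mul_nonneg_right h2 ?_
  rw [measureReal_def, ENNReal.toReal_pos_iff]
  refine ⟨?_, measure_lt_top _ _⟩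
  rw [pos_iff_ne_zero, Ne, Measure.measure_univ_eq_zero]
  exact μ.toSphere_ne_zero

end Polar

/-! ### The logarithmic cutoff and its derivatives -/

section Cutoff

variable {n : ℕ} {x : EuclideanSpace ℝ (Fin n)}

lemma deriv_smoothTransition_eq_zero {t : ℝ} (ht : t ∉ Icc (0 : ℝ) 1) :
    deriv Real.smoothTransition t = 0 ∧ deriv (deriv Real.smoothTransition) t = 0 := by
  have key : ∃ c : ℝ, Real.smoothTransition =ᶠ[𝓝 t] fun _ => c := by
    rcases lt_or_ge t 0 with h | h
    · refine ⟨0, ?_⟩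
      filter_upwards [Iio_mem_nhds h] with s hs using Real.smoothTransition.zero_of_nonpos hs.le
    · have h1 : 1 < t := by
        by_contra h1
        exact ht ⟨h, not_lt.1 h1⟩
      refine ⟨1, ?_⟩
      filter_upwards [Ioi_mem_nhds h1] with s hs using Real.smoothTransition.one_of_one_le hs.le
  obtain ⟨c, hc⟩ := key
  have h1 : deriv Real.smoothTransition =ᶠ[𝓝 t] fun _ => 0 := by
    simpa using hc.deriv
  exact ⟨h1.eq_of_nhds, by simpa using h1.deriv_eq⟩

lemma contDiff_deriv_smoothTransition : ContDiff ℝ ∞ (deriv Real.smoothTransition) :=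
  (contDiff_infty_iff_deriv.1 Real.smoothTransition.contDiff).2

lemma exists_bound_deriv_smoothTransition : ∃ C : ℝ, 0 ≤ C ∧
    ∀ t, |deriv Real.smoothTransition t| ≤ C ∧ |deriv (deriv Real.smoothTransition) t| ≤ C := by
  have h1 := contDiff_deriv_smoothTransition.continuous
  have h2 := contDiff_deriv_smoothTransition.continuous_deriv (by simp)
  obtain ⟨C1, hC1⟩ := isCompact_Icc.exists_bound_of_continuousOn (s := Icc (0 : ℝ) 1) h1.continuousOn
  obtain ⟨C2, hC2⟩ := isCompact_Icc.exists_bound_of_continuousOn (s := Icc (0 : ℝ) 1) h2.continuousOn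
  refine ⟨max 0 (max C1 C2), le_max_left _ _, fun t => ?_⟩
  by_cases ht : t ∈ Icc (0 : ℝ) 1
  · exact ⟨(hC1 t ht).trans (by simp), (hC2 t ht).trans (by simp)⟩
  · simp [deriv_smoothTransition_eq_zero ht]

/-- The argument of the logarithmic cutoff. -/
noncomputable def logProfile (K : ℝ) (x : EuclideanSpace ℝ (Fin n)) : ℝ :=
  3 + Real.log (‖x‖ ^ 2 + Real.exp (-4 * K)) / K

/-- A smooth logarithmic cutoff, vanishing near the origin. -/
noncomputable def logCutoff (K : ℝ) (x : EuclideanSpace ℝ (Fin n)) : ℝ :=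
  Real.smoothTransition (logProfile K x)

lemma contDiff_logProfile (K : ℝ) :
    ContDiff ℝ ∞ (logProfile K : EuclideanSpace ℝ (Fin n) → ℝ) := by
  have : ∀ x : EuclideanSpace ℝ (Fin n), ‖x‖ ^ 2 + Real.exp (-4 * K) ≠ 0 := fun x => by positivity
  exact contDiff_const.add ((((contDiff_norm_sq ℝ).add contDiff_const).log this).div_const K)

lemma contDiff_logCutoff (K : ℝ) :
    ContDiff ℝ ∞ (logCutoff K : EuclideanSpace ℝ (Fin n) → ℝ) :=
  Real.smoothTransition.contDiff.comp (contDiff_logProfile K)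

lemma partialDeriv_comp {g : ℝ → ℝ} {w : EuclideanSpace ℝ (Fin n) → ℝ} (i : Fin n)
    (hg : DifferentiableAt ℝ g (w x)) (hw : DifferentiableAt ℝ w x) :
    partialDeriv i (fun y => g (w y)) x = deriv g (w x) * partialDeriv i w x := by
  have := (hg.hasDerivAt.comp_hasFDerivAt x hw.hasFDerivAt).fderiv
  simp only [partialDeriv]
  change fderiv ℝ (g ∘ w) x _ = _
  simp [this]

lemma partialDeriv_norm_sq (i : Fin n) :
    partialDeriv i (fun y : EuclideanSpace ℝ (Fin n) => ‖y‖ ^ 2) x = 2 * x i := by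
  simp [partialDeriv, fderiv_norm_sq_apply, EuclideanSpace.inner_single_right]

lemma partialDeriv_logProfile {K : ℝ} (i : Fin n) :
    partialDeriv i (logProfile K) x = 2 / K * (x i * (‖x‖ ^ 2 + Real.exp (-4 * K))⁻¹) := by
  have hq : ‖x‖ ^ 2 + Real.exp (-4 * K) ≠ 0 := by positivity
  have hd : DifferentiableAt ℝ (fun y : EuclideanSpace ℝ (Fin n) => ‖y‖ ^ 2) x :=
    (contDiff_norm_sq ℝ (n := 1)).differentiable (by simp) x
  have hg : HasDerivAt (fun t => 3 + Real.log (t + Real.exp (-4 * K)) / K)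
      ((‖x‖ ^ 2 + Real.exp (-4 * K))⁻¹ / K) (‖x‖ ^ 2) := by
    have := ((((hasDerivAt_id (‖x‖ ^ 2)).add_const (Real.exp (-4 * K))).log hq).div_const K).const_add 3
    simpa using this
  have h : partialDeriv i (logProfile K) x = _ :=
    partialDeriv_comp (g := fun t => 3 + Real.log (t + Real.exp (-4 * K)) / K)
      (w := fun y => ‖y‖ ^ 2) i hg.differentiableAt hd
  rw [h, hg.deriv, partialDeriv_norm_sq]
  ring

lemma partialDeriv_partialDeriv_logProfile {K : ℝ} (i : Fin n) :
    partialDeriv i (partialDeriv i (logProfile K)) x =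
      2 / K * ((‖x‖ ^ 2 + Real.exp (-4 * K))⁻¹ -
        2 * x i ^ 2 * (‖x‖ ^ 2 + Real.exp (-4 * K))⁻¹ ^ 2) := by
  have hq : ‖x‖ ^ 2 + Real.exp (-4 * K) ≠ 0 := by positivity
  have hd : DifferentiableAt ℝ (fun y : EuclideanSpace ℝ (Fin n) => ‖y‖ ^ 2) x :=
    (contDiff_norm_sq ℝ (n := 1)).differentiable (by simp) x
  have hg : HasDerivAt (fun t => (t + Real.exp (-4 * K))⁻¹)
      (-(‖x‖ ^ 2 + Real.exp (-4 * K))⁻¹ ^ 2) (‖x‖ ^ 2) := by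
    have := ((hasDerivAt_id (‖x‖ ^ 2)).add_const (Real.exp (-4 * K))).fun_inv hq
    refine this.congr_deriv ?_
    rw [inv_pow]
    simp [neg_div]
  have h1 : partialDeriv i (logProfile K) = fun y : EuclideanSpace ℝ (Fin n) =>
      2 / K * (y i * (‖y‖ ^ 2 + Real.exp (-4 * K))⁻¹) := by
    ext y; exact partialDeriv_logProfile i
  have hd2 : DifferentiableAt ℝ (fun y : EuclideanSpace ℝ (Fin n) =>
      (‖y‖ ^ 2 + Real.exp (-4 * K))⁻¹) x := (hd.add_const _).inv hq
  have h2 : partialDeriv i (fun y : EuclideanSpace ℝ (Fin n) =>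
      (‖y‖ ^ 2 + Real.exp (-4 * K))⁻¹) x = _ :=
    partialDeriv_comp (g := fun t => (t + Real.exp (-4 * K))⁻¹)
      (w := fun y => ‖y‖ ^ 2) i hg.differentiableAt hd
  rw [h1, partialDeriv_const_mul i _ (by exact (differentiableAt_coord i).mul hd2),
    partialDeriv_mul i (differentiableAt_coord i) hd2, h2, hg.deriv, partialDeriv_norm_sq,
    partialDeriv_coord, if_pos rfl]
  ring

lemma partialDeriv_logCutoff {K : ℝ} (i : Fin n) :
    partialDeriv i (logCutoff K) x =
      deriv Real.smoothTransition (logProfile K x) * partialDeriv i (logProfile K) x :=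
  partialDeriv_comp i (Real.smoothTransition.contDiff (n := 1) |>.differentiable (by simp) _)
    ((contDiff_logProfile K).differentiable (by simp) x)

lemma contDiff_partialDeriv {v : EuclideanSpace ℝ (Fin n) → ℝ} (hv : ContDiff ℝ ∞ v) (i : Fin n) :
    ContDiff ℝ ∞ (partialDeriv i v) :=
  (hv.fderiv_right (m := ∞) (by simp)).clm_apply contDiff_const

lemma partialDeriv_partialDeriv_logCutoff {K : ℝ} (i : Fin n) :
    partialDeriv i (partialDeriv i (logCutoff K)) x =
      deriv (deriv Real.smoothTransition) (logProfile K x) * partialDeriv i (logProfile K) x ^ 2 +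
      deriv Real.smoothTransition (logProfile K x) *
        partialDeriv i (partialDeriv i (logProfile K)) x := by
  have h1 : partialDeriv i (logCutoff K) = fun y : EuclideanSpace ℝ (Fin n) =>
      deriv Real.smoothTransition (logProfile K y) * partialDeriv i (logProfile K) y := by
    ext y; exact partialDeriv_logCutoff i
  have hd := (contDiff_logProfile (n := n) K).differentiable (by simp) x
  have hg := contDiff_deriv_smoothTransition.differentiable (by simp) (logProfile K x)
  rw [h1, partialDeriv_mul i (by exact hg.comp x hd)
    ((contDiff_partialDeriv (contDiff_logProfile K) i).differentiable (by simp) x),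
    partialDeriv_comp i hg hd]
  ring

/-- The size of the error terms created by the logarithmic cutoff. -/
noncomputable def cutoffError (K r : ℝ) : ℝ :=
  (Iic (Real.exp (-K))).indicator 1 r +
    (Icc (Real.exp (-2 * K)) (Real.exp (-K))).indicator (fun r => (K * r ^ 2)⁻¹) r

lemma cutoffError_nonneg {K : ℝ} (hK : 0 ≤ K) (r : ℝ) : 0 ≤ cutoffError K r :=
  add_nonneg (indicator_nonneg (fun _ _ => zero_le_one) _)
    (indicator_nonneg (fun _ _ => by positivity) _)

/-- The transition takes place where `log (|x|² + e^(-4K))` lies in `[-3K, -2K]`. The shift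
`e^(-4K)` keeps the logarithm smooth at the origin, where the profile equals `-1`; it is small
enough that `|x|` stays above `e^(-2K)`. -/
lemma logProfile_mem_Icc {K : ℝ} (hK : 1 ≤ K) (h : logProfile K x ∈ Icc (0 : ℝ) 1) :
    ‖x‖ ^ 2 + Real.exp (-4 * K) ≤ 1 ∧ ‖x‖ ∈ Icc (Real.exp (-2 * K)) (Real.exp (-K)) := by
  have hK0 : 0 < K := by linarith
  have hq : 0 < ‖x‖ ^ 2 + Real.exp (-4 * K) := by positivity
  obtain ⟨h0, h1⟩ := h
  simp only [logProfile] at h0 h1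
  have h0' : -3 * K ≤ Real.log (‖x‖ ^ 2 + Real.exp (-4 * K)) := by
    have : -3 ≤ Real.log (‖x‖ ^ 2 + Real.exp (-4 * K)) / K := by linarith
    rwa [le_div_iff₀ hK0] at this
  have h1' : Real.log (‖x‖ ^ 2 + Real.exp (-4 * K)) ≤ -2 * K := by
    have : Real.log (‖x‖ ^ 2 + Real.exp (-4 * K)) / K ≤ -2 := by linarith
    rwa [div_le_iff₀ hK0] at this
  rw [Real.le_log_iff_exp_le hq] at h0'
  rw [Real.log_le_iff_le_exp hq] at h1'
  have e2 : Real.exp (-2 * K) = Real.exp (-K) ^ 2 := by rw [← Real.exp_nat_mul]; ring_nf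
  have e4 : Real.exp (-4 * K) = Real.exp (-2 * K) ^ 2 := by rw [← Real.exp_nat_mul]; ring_nf
  refine ⟨h1'.trans (Real.exp_le_one_iff.2 (by linarith)), ?_, ?_⟩
  · have h34 : 2 * Real.exp (-4 * K) ≤ Real.exp (-3 * K) := by
      have : Real.exp (-3 * K) = Real.exp K * Real.exp (-4 * K) := by
        rw [← Real.exp_add]; ring_nf
      rw [this]
      gcongr
      linarith [Real.add_one_le_exp K]
    refine le_of_sq_le_sq ?_ (norm_nonneg x)
    rw [← e4]
    linarith
  · refine le_of_sq_le_sq ?_ (Real.exp_pos _).le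
    rw [← e2]
    linarith [Real.exp_pos (-4 * K)]

lemma abs_logCutoff_sub_one_le {K : ℝ} (hK : 1 ≤ K) (x : EuclideanSpace ℝ (Fin n)) :
    |logCutoff K x - 1| ≤ cutoffError K ‖x‖ := by
  have hK0 : 0 < K := by linarith
  by_cases hx : ‖x‖ ≤ Real.exp (-K)
  · have h1 : |logCutoff K x - 1| ≤ 1 := by
      have h0 := Real.smoothTransition.nonneg (logProfile K x)
      have h1 := Real.smoothTransition.le_one (logProfile K x)
      rw [logCutoff, abs_le]
      constructor <;> linarith
    refine h1.trans ?_
    rw [cutoffError, indicator_of_mem (by exact hx)]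
    simp only [Pi.one_apply, le_add_iff_nonneg_right]
    exact indicator_nonneg (fun _ _ => by positivity) _
  · have : logCutoff K x = 1 := by
      refine Real.smoothTransition.one_of_one_le ?_
      have hq : 0 < ‖x‖ ^ 2 + Real.exp (-4 * K) := by positivity
      have : -2 ≤ Real.log (‖x‖ ^ 2 + Real.exp (-4 * K)) / K := by
        rw [le_div_iff₀ hK0, Real.le_log_iff_exp_le hq]
        have e2 : Real.exp (-2 * K) = Real.exp (-K) ^ 2 := by rw [← Real.exp_nat_mul]; ring_nf
        rw [e2]
        have := pow_le_pow_left₀ (Real.exp_pos (-K)).le (not_le.1 hx).le 2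
        linarith [Real.exp_pos (-4 * K)]
      rw [logProfile]
      linarith
    rw [this]
    simpa using cutoffError_nonneg hK0.le _

lemma logCutoff_eventuallyEq_zero {K : ℝ} (hK : 1 ≤ K) :
    (logCutoff K : EuclideanSpace ℝ (Fin n) → ℝ) =ᶠ[𝓝 0] 0 := by
  have hK0 : 0 < K := by linarith
  have h0 : logProfile K (0 : EuclideanSpace ℝ (Fin n)) < 0 := by
    simp only [logProfile, norm_zero]
    rw [zero_pow two_ne_zero, zero_add, Real.log_exp, mul_div_cancel_right₀ _ hK0.ne']
    norm_num
  filter_upwards [(contDiff_logProfile (n := n) K).continuous.continuousAt.eventually_lt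
    continuousAt_const h0] with y hy using Real.smoothTransition.zero_of_nonpos hy.le

/-- Differentiating the logarithm gives `O(1/(Kr))` once and `O(1/(Kr²))` twice, and `r ≤ 1` puts
both under one error function. Unmixed second derivatives suffice for the Laplacian. -/
lemma exists_bound_partialDeriv_logCutoff : ∃ C : ℝ, 0 ≤ C ∧ ∀ (K : ℝ), 1 ≤ K →
    ∀ (i : Fin n) (x : EuclideanSpace ℝ (Fin n)),
      |partialDeriv i (logCutoff K) x| ≤ C * cutoffError K ‖x‖ ∧
      |partialDeriv i (partialDeriv i (logCutoff K)) x| ≤ C * cutoffError K ‖x‖ := by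
  obtain ⟨C, hC0, hC⟩ := exists_bound_deriv_smoothTransition
  -- `10 = 4 + 6`: the square of the first derivative of the profile (`b2`) and its second
  -- derivative (`b3`).
  refine ⟨10 * C, by positivity, fun K hK i x => ?_⟩
  have hK0 : 0 < K := by linarith
  rw [partialDeriv_partialDeriv_logCutoff, partialDeriv_logCutoff]
  by_cases hs : logProfile K x ∈ Icc (0 : ℝ) 1
  · obtain ⟨hq1, hmem⟩ := logProfile_mem_Icc hK hs
    obtain ⟨hC1, hC2⟩ := hC (logProfile K x)
    have hxpos : 0 < ‖x‖ := (Real.exp_pos _).trans_le hmem.1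
    have hxi : x i ^ 2 ≤ ‖x‖ ^ 2 := by
      rw [← sq_abs]
      exact pow_le_pow_left₀ (abs_nonneg _) (PiLp.norm_apply_le x i) 2
    have herr : (K * ‖x‖ ^ 2)⁻¹ ≤ cutoffError K ‖x‖ := by
      rw [cutoffError, indicator_of_mem (s := Icc _ _) hmem, indicator_of_mem (by exact hmem.2)]
      simp
    rw [partialDeriv_partialDeriv_logProfile, partialDeriv_logProfile]
    set q := ‖x‖ ^ 2 + Real.exp (-4 * K) with hq
    have hq0 : 0 < q := by positivity
    have hxq : ‖x‖ ^ 2 ≤ q := by rw [hq]; linarith [Real.exp_pos (-4 * K)]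
    have hmain : (K * q)⁻¹ ≤ cutoffError K ‖x‖ :=
      (inv_anti₀ (by positivity) (by gcongr)).trans herr
    have hxi1 : |x i| ≤ 1 :=
      abs_le_of_sq_le_sq (by linarith) zero_le_one
    have hxiq : x i ^ 2 * q⁻¹ ≤ 1 := by
      rw [← div_eq_mul_inv, div_le_one hq0]
      exact hxi.trans hxq
    have b1 : |2 / K * (x i * q⁻¹)| ≤ 2 * (K * q)⁻¹ := by
      rw [abs_mul, abs_mul, abs_of_pos (by positivity : 0 < 2 / K), abs_of_pos (inv_pos.2 hq0),
        mul_inv]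
      have : 2 / K * (|x i| * q⁻¹) = 2 * (K⁻¹ * q⁻¹) * |x i| := by ring
      rw [this]
      exact mul_le_of_le_one_right (by positivity) hxi1
    have b2 : (2 / K * (x i * q⁻¹)) ^ 2 ≤ 4 * (K * q)⁻¹ := by
      have : (2 / K * (x i * q⁻¹)) ^ 2 = 4 * (K * q)⁻¹ * (K⁻¹ * (x i ^ 2 * q⁻¹)) := by
        rw [mul_inv]; ring
      rw [this]
      refine mul_le_of_le_one_right (by positivity) ?_
      exact mul_le_one₀ (inv_le_one_of_one_le₀ hK) (by positivity) hxiq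
    have b3 : |2 / K * (q⁻¹ - 2 * x i ^ 2 * q⁻¹ ^ 2)| ≤ 6 * (K * q)⁻¹ := by
      have : 2 / K * (q⁻¹ - 2 * x i ^ 2 * q⁻¹ ^ 2) =
          (K * q)⁻¹ * (2 * (1 - 2 * (x i ^ 2 * q⁻¹))) := by rw [mul_inv]; ring
      rw [this, abs_mul, abs_of_pos (by positivity : 0 < (K * q)⁻¹), mul_comm]
      gcongr
      have : 0 ≤ x i ^ 2 * q⁻¹ := by positivity
      rw [abs_le]
      constructor <;> linarith
    constructor
    · rw [abs_mul]
      calc _ ≤ C * (2 * (K * q)⁻¹) := mul_le_mul hC1 b1 (abs_nonneg _) hC0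
        _ ≤ C * (10 * (K * q)⁻¹) := by gcongr; norm_num
        _ = 10 * C * (K * q)⁻¹ := by ring
        _ ≤ _ := by gcongr
    · refine (abs_add_le _ _).trans ?_
      rw [abs_mul, abs_mul, abs_of_nonneg (sq_nonneg (2 / K * (x i * q⁻¹)))]
      calc _ ≤ C * (4 * (K * q)⁻¹) + C * (6 * (K * q)⁻¹) := by
            gcongr
        _ = 10 * C * (K * q)⁻¹ := by ring
        _ ≤ _ := by gcongr
  · have h := deriv_smoothTransition_eq_zero hs
    have := cutoffError_nonneg hK0.le ‖x‖
    simp [h.1, h.2]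
    positivity

end Cutoff

/-! ### Removal of the origin, and lower semicontinuity in `L²` -/

section Approximation

variable {n : ℕ} {Ω : Set (EuclideanSpace ℝ (Fin n))}

lemma eLpNorm_two_sq {α : Type*} [MeasurableSpace α] (μ : Measure α) (f : α → ℝ) :
    eLpNorm f 2 μ ^ 2 = ∫⁻ x, ENNReal.ofReal (f x ^ 2) ∂μ := by
  have h := eLpNorm_nnreal_pow_eq_lintegral (p := 2) (f := f) (μ := μ) (by norm_num)
  have h2 : ((2 : NNReal) : ℝ) = ((2 : ℕ) : ℝ) := by norm_num
  rw [h2, ENNReal.rpow_natCast] at h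
  simp only [ENNReal.rpow_natCast] at h
  refine (Eq.trans (by norm_num) h).trans (lintegral_congr fun x => ?_)
  rw [Real.enorm_eq_ofReal_abs, ← ENNReal.ofReal_pow (abs_nonneg _), sq_abs]

lemma measurable_cutoffError (K : ℝ) : Measurable (cutoffError K) := by
  unfold cutoffError
  refine (measurable_one.indicator measurableSet_Iic).add (Measurable.indicator ?_ measurableSet_Icc)
  fun_prop

lemma cutoffError_sq_le (K r : ℝ) :
    cutoffError K r ^ 2 ≤ 2 * (Iic (Real.exp (-K))).indicator 1 r +
      2 * (Icc (Real.exp (-2 * K)) (Real.exp (-K))).indicator (fun r => (K ^ 2 * r ^ 4)⁻¹) r := by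
  unfold cutoffError
  have h1 : (Iic (Real.exp (-K))).indicator (1 : ℝ → ℝ) r ^ 2 =
      (Iic (Real.exp (-K))).indicator 1 r := by
    by_cases h : r ∈ Iic (Real.exp (-K)) <;> simp [h]
  have h2 : (Icc (Real.exp (-2 * K)) (Real.exp (-K))).indicator (fun r => (K * r ^ 2)⁻¹) r ^ 2 =
      (Icc (Real.exp (-2 * K)) (Real.exp (-K))).indicator (fun r => (K ^ 2 * r ^ 4)⁻¹) r := by
    by_cases h : r ∈ Icc (Real.exp (-2 * K)) (Real.exp (-K))
    · simp only [indicator_of_mem h]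
      rw [inv_pow]
      congr 1
      ring
    · simp only [indicator_of_notMem h]
      norm_num
  nlinarith [sq_nonneg ((Iic (Real.exp (-K))).indicator (1 : ℝ → ℝ) r -
    (Icc (Real.exp (-2 * K)) (Real.exp (-K))).indicator (fun r => (K * r ^ 2)⁻¹) r)]

/-- Dimension four is borderline: for `r ≤ 1`, `r^(n-1) (K r²)⁻² ≤ K⁻² r⁻¹`, and `1/r` has integral
`K` over `[e^(-2K), e^(-K)]`. The remaining `1/K` still tends to zero, which is the gain of a
logarithmic cutoff. -/
lemma integrableOn_and_setIntegral_bound (hn : 4 ≤ n) {K : ℝ} (hK : 1 ≤ K) :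
    IntegrableOn (fun r : ℝ => r ^ (n - 1) * cutoffError K r ^ 2) (Ioi 0) ∧
    ∫ r in Ioi (0 : ℝ), r ^ (n - 1) * cutoffError K r ^ 2 ≤ 2 * Real.exp (-K) + 2 / K := by
  have hK0 : 0 < K := by linarith
  have hab : Real.exp (-2 * K) ≤ Real.exp (-K) := Real.exp_le_exp.2 (by linarith)
  have hb1 : Real.exp (-K) ≤ 1 := Real.exp_le_one_iff.2 (by linarith)
  have hInv : IntegrableOn (fun r : ℝ => r⁻¹) (Icc (Real.exp (-2 * K)) (Real.exp (-K))) :=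
    (continuousOn_inv₀.mono fun r hr => ((Real.exp_pos _).trans_le hr.1).ne').integrableOn_Icc
  set g : ℝ → ℝ := fun r => 2 * (Ioc 0 (Real.exp (-K))).indicator 1 r +
    2 / K ^ 2 * (Icc (Real.exp (-2 * K)) (Real.exp (-K))).indicator (fun r => r⁻¹) r with hg
  have i1 : Integrable ((Ioc 0 (Real.exp (-K))).indicator (1 : ℝ → ℝ)) := by
    rw [integrable_indicator_iff measurableSet_Ioc]
    exact integrableOn_const (by simp)
  have i2 : Integrable ((Icc (Real.exp (-2 * K)) (Real.exp (-K))).indicator fun r : ℝ => r⁻¹) := by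
    rwa [integrable_indicator_iff measurableSet_Icc]
  have ig : Integrable g := (i1.const_mul 2).add (i2.const_mul _)
  have hle : ∀ r ∈ Ioi (0 : ℝ), r ^ (n - 1) * cutoffError K r ^ 2 ≤ g r := by
    intro r hr
    have hr0 : 0 < r := hr
    refine (mul_le_mul_of_nonneg_left (cutoffError_sq_le K r) (by positivity)).trans ?_
    simp only [hg]
    by_cases h1 : r ≤ Real.exp (-K)
    · have hr1 : r ≤ 1 := h1.trans hb1
      rw [indicator_of_mem (s := Iic _) (by exact h1), indicator_of_mem (s := Ioc _ _) ⟨hr0, h1⟩]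
      by_cases h2 : r ∈ Icc (Real.exp (-2 * K)) (Real.exp (-K))
      · rw [indicator_of_mem h2, indicator_of_mem h2]
        have a1 : r ^ (n - 1) ≤ 1 := pow_le_one₀ hr0.le hr1
        have a2 : r ^ (n - 1) ≤ r ^ 3 := pow_le_pow_of_le_one hr0.le hr1 (by omega)
        have a3 : r ^ (n - 1) * (K ^ 2 * r ^ 4)⁻¹ ≤ r ^ 3 * (K ^ 2 * r ^ 4)⁻¹ := by gcongr
        have a4 : r ^ 3 * (K ^ 2 * r ^ 4)⁻¹ = 1 / K ^ 2 * r⁻¹ := by field_simp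
        have a5 : 2 / K ^ 2 * r⁻¹ = 2 * (1 / K ^ 2 * r⁻¹) := by ring
        simp only [Pi.one_apply]
        rw [a5]
        linarith
      · rw [indicator_of_notMem h2, indicator_of_notMem h2]
        have a1 : r ^ (n - 1) ≤ 1 := pow_le_one₀ hr0.le hr1
        simp only [Pi.one_apply]
        linarith
    · have h2 : r ∉ Icc (Real.exp (-2 * K)) (Real.exp (-K)) := fun h => h1 h.2
      have h3 : r ∉ Ioc 0 (Real.exp (-K)) := fun h => h1 h.2
      rw [indicator_of_notMem (s := Iic _) (by exact h1), indicator_of_notMem h2,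
        indicator_of_notMem h2, indicator_of_notMem h3]
      simp
  have hint : IntegrableOn (fun r : ℝ => r ^ (n - 1) * cutoffError K r ^ 2) (Ioi 0) := by
    refine Integrable.mono' ig.integrableOn
      ((measurable_id.pow_const _).mul ((measurable_cutoffError K).pow_const 2)).aestronglyMeasurable
      ?_
    filter_upwards [ae_restrict_mem measurableSet_Ioi] with r hr
    have hr0 : 0 < r := hr
    rw [Real.norm_of_nonneg (by positivity)]
    exact hle r hr
  refine ⟨hint, (setIntegral_mono_on hint ig.integrableOn measurableSet_Ioi hle).trans ?_⟩
  have hg0 : ∀ r, 0 ≤ g r := fun r => by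
    refine add_nonneg (mul_nonneg zero_le_two (indicator_nonneg (fun _ _ => zero_le_one) _))
      (mul_nonneg (by positivity) (indicator_nonneg (fun r hr => ?_) _))
    exact inv_nonneg.2 ((Real.exp_pos _).le.trans hr.1)
  refine (setIntegral_le_integral ig (.of_forall hg0)).trans ?_
  have e1 : ∫ r, (Ioc 0 (Real.exp (-K))).indicator (1 : ℝ → ℝ) r = Real.exp (-K) := by
    rw [integral_indicator measurableSet_Ioc]
    simp [Real.exp_nonneg]
  have e2 : ∫ r, (Icc (Real.exp (-2 * K)) (Real.exp (-K))).indicator (fun r => r⁻¹) r = K := by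
    rw [integral_indicator measurableSet_Icc, integral_Icc_eq_integral_Ioc,
      ← intervalIntegral.integral_of_le hab, integral_inv_of_pos (Real.exp_pos _) (Real.exp_pos _),
      ← Real.exp_sub, Real.log_exp]
    ring
  have i1' : Integrable (fun r => 2 * (Ioc 0 (Real.exp (-K))).indicator (1 : ℝ → ℝ) r) :=
    i1.const_mul 2
  simp only [hg]
  rw [integral_add i1' (i2.const_mul _), integral_const_mul, integral_const_mul, e1, e2]
  apply le_of_eq
  field_simp

lemma tendsto_eLpNorm_cutoffError (hn : 4 ≤ n) :
    Tendsto (fun k : ℕ => eLpNorm (fun x : EuclideanSpace ℝ (Fin n) => cutoffError (k + 1) ‖x‖) 2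
      volume) atTop (𝓝 0) := by
  have hnt : Nontrivial (EuclideanSpace ℝ (Fin n)) := by
    refine ⟨⟨EuclideanSpace.single ⟨0, by omega⟩ 1, 0, ?_⟩⟩
    simp
  set c : ℝ := n * volume.real (Metric.ball (0 : EuclideanSpace ℝ (Fin n)) 1) with hc
  have hc0 : 0 ≤ c := by positivity
  have hsq : ∀ k : ℕ, eLpNorm (fun x : EuclideanSpace ℝ (Fin n) => cutoffError (k + 1) ‖x‖) 2
      volume ^ 2 ≤ ENNReal.ofReal (c * (2 * Real.exp (-((k : ℝ) + 1)) + 2 / ((k : ℝ) + 1))) := by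
    intro k
    have hk : (1 : ℝ) ≤ k + 1 := by linarith [(Nat.cast_nonneg k : (0 : ℝ) ≤ k)]
    obtain ⟨hi, hb⟩ := integrableOn_and_setIntegral_bound hn hk
    have hi' : Integrable (fun x : EuclideanSpace ℝ (Fin n) => cutoffError (k + 1) ‖x‖ ^ 2) := by
      rw [integrable_fun_norm_addHaar volume (f := fun r => cutoffError (k + 1) r ^ 2)]
      simpa using hi
    rw [eLpNorm_two_sq, ← ofReal_integral_eq_lintegral_ofReal hi' (.of_forall fun x => sq_nonneg _)]
    refine ENNReal.ofReal_le_ofReal ?_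
    rw [integral_fun_norm_addHaar volume (fun r => cutoffError (k + 1) r ^ 2)]
    simp only [finrank_euclideanSpace, Fintype.card_fin, smul_eq_mul, nsmul_eq_mul]
    rw [← mul_assoc]
    exact mul_le_mul_of_nonneg_left hb hc0
  have hlim : Tendsto (fun k : ℕ => ENNReal.ofReal
      (c * (2 * Real.exp (-((k : ℝ) + 1)) + 2 / ((k : ℝ) + 1)))) atTop (𝓝 0) := by
    have h1 : Tendsto (fun k : ℕ => (k : ℝ) + 1) atTop atTop :=
      tendsto_atTop_add_const_right _ _ tendsto_natCast_atTop_atTop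
    have h2 : Tendsto (fun k : ℕ => Real.exp (-((k : ℝ) + 1))) atTop (𝓝 0) :=
      Real.tendsto_exp_neg_atTop_nhds_zero.comp h1
    have h3 : Tendsto (fun k : ℕ => 2 / ((k : ℝ) + 1)) atTop (𝓝 0) := h1.const_div_atTop 2
    have h4 := ((h2.const_mul 2).add h3).const_mul c
    simpa using ENNReal.tendsto_ofReal h4
  have hsq0 := tendsto_of_tendsto_of_tendsto_of_le_of_le tendsto_const_nhds hlim
    (fun _ => zero_le) hsq
  have h := hsq0.ennrpow_const (1 / 2)
  have hroot : ∀ a : ENNReal, (a ^ 2) ^ (1 / 2 : ℝ) = a := fun a => by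
    rw [← ENNReal.rpow_natCast, ← ENNReal.rpow_mul]
    norm_num
  simp only [hroot] at h
  simpa using h

lemma tendstoL2_of_abs_le (hn : 4 ≤ n) {w : ℕ → EuclideanSpace ℝ (Fin n) → ℝ}
    {v : EuclideanSpace ℝ (Fin n) → ℝ} (C : ℝ)
    (h : ∀ (k : ℕ) x, |w k x - v x| ≤ C * cutoffError (k + 1) ‖x‖) : TendstoL2 Ω w v := by
  have hlim : Tendsto (fun k : ℕ => ENNReal.ofReal C *
      eLpNorm (fun x : EuclideanSpace ℝ (Fin n) => cutoffError (k + 1) ‖x‖) 2 volume) atTop (𝓝 0) := by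
    simpa using ENNReal.Tendsto.const_mul (tendsto_eLpNorm_cutoffError hn)
      (.inr (ENNReal.ofReal_ne_top (r := C)))
  refine tendsto_of_tendsto_of_tendsto_of_le_of_le tendsto_const_nhds hlim (fun _ => zero_le)
    fun k => (eLpNorm_mono_measure _ Measure.restrict_le_self).trans ?_
  refine eLpNorm_le_mul_eLpNorm_of_ae_le_mul (.of_forall fun x => ?_) 2
  have hk : (0 : ℝ) ≤ k + 1 := by positivity
  rw [Real.norm_of_nonneg (cutoffError_nonneg hk _)]
  exact h k x

lemma IsTestFunction.exists_bound {v : EuclideanSpace ℝ (Fin n) → ℝ} (hv : IsTestFunction Ω v) :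
    ∃ B, 0 ≤ B ∧ ∀ x, |v x| ≤ B := by
  obtain ⟨B, hB⟩ := hv.hasCompactSupport.exists_bound_of_continuous hv.continuous
  exact ⟨B, (norm_nonneg _).trans (hB 0), hB⟩

/-- Points have vanishing capacity in `H²` if the dimension is at least four. -/
lemma exists_testFunction_approx_away_from_zero (hn : 4 ≤ n)
    {φ : EuclideanSpace ℝ (Fin n) → ℝ} (hφ : IsTestFunction Ω φ) :
    ∃ ψ : ℕ → EuclideanSpace ℝ (Fin n) → ℝ, (∀ k, IsTestFunction (Ω \ {0}) (ψ k)) ∧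
      TendstoL2 Ω ψ φ ∧
      (∀ i, TendstoL2 Ω (fun k => partialDeriv i (ψ k)) (partialDeriv i φ)) ∧
      ∀ i, TendstoL2 Ω (fun k => partialDeriv i (partialDeriv i (ψ k)))
        (partialDeriv i (partialDeriv i φ)) := by
  obtain ⟨C, hC0, hC⟩ := exists_bound_partialDeriv_logCutoff (n := n)
  obtain ⟨B0, hB0, hb0⟩ := hφ.exists_bound
  have hK : ∀ k : ℕ, (1 : ℝ) ≤ k + 1 := fun k => by
    linarith [(Nat.cast_nonneg k : (0 : ℝ) ≤ k)]
  have hη : ∀ k : ℕ, ContDiff ℝ ∞ (logCutoff ((k : ℝ) + 1) : EuclideanSpace ℝ (Fin n) → ℝ) :=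
    fun k => contDiff_logCutoff _
  have hηd : ∀ (k : ℕ) x, DifferentiableAt ℝ
      (logCutoff ((k : ℝ) + 1) : EuclideanSpace ℝ (Fin n) → ℝ) x :=
    fun k x => (hη k).differentiable (by simp) x
  have hηd' : ∀ (k : ℕ) i x, DifferentiableAt ℝ (partialDeriv i
      (logCutoff ((k : ℝ) + 1) : EuclideanSpace ℝ (Fin n) → ℝ)) x :=
    fun k i x => (contDiff_partialDeriv (hη k) i).differentiable (by simp) x
  have e1 : ∀ (k : ℕ) i, partialDeriv i (fun x => logCutoff ((k : ℝ) + 1) x * φ x) =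
      fun x => logCutoff ((k : ℝ) + 1) x * partialDeriv i φ x +
        partialDeriv i (logCutoff ((k : ℝ) + 1)) x * φ x := fun k i => by
    ext x; exact partialDeriv_mul i (hηd k x) hφ.differentiableAt
  -- By the Leibniz rule each difference has a factor `η - 1` or a derivative of the cutoff `η`,
  -- against bounded derivatives of `φ`.
  refine ⟨fun k x => logCutoff ((k : ℝ) + 1) x * φ x, fun k => ?_, ?_, fun i => ?_, fun i => ?_⟩
  · have ht := (hφ.mono (subset_univ _)).smooth_mul isOpen_univ (hη k).contDiffOn
    refine ⟨ht.1, ht.2.1, fun x hx => ⟨hφ.2.2 (tsupport_mul_subset_right hx), ?_⟩⟩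
    rintro rfl
    have h0 := logCutoff_eventuallyEq_zero (n := n) (hK k)
    refine (notMem_tsupport_iff_eventuallyEq.2 h0) (tsupport_mul_subset_left hx)
  · refine tendstoL2_of_abs_le hn B0 fun k x => ?_
    have : logCutoff ((k : ℝ) + 1) x * φ x - φ x = φ x * (logCutoff ((k : ℝ) + 1) x - 1) := by ring
    rw [this, abs_mul]
    exact mul_le_mul (hb0 x) (abs_logCutoff_sub_one_le (hK k) x) (abs_nonneg _) hB0
  · obtain ⟨B1, hB1, hb1⟩ := (hφ.partialDeriv i).exists_bound
    refine tendstoL2_of_abs_le hn (B1 + B0 * C) fun k x => ?_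
    simp only [e1]
    have : logCutoff ((k : ℝ) + 1) x * partialDeriv i φ x +
        partialDeriv i (logCutoff ((k : ℝ) + 1)) x * φ x - partialDeriv i φ x =
        partialDeriv i φ x * (logCutoff ((k : ℝ) + 1) x - 1) +
        φ x * partialDeriv i (logCutoff ((k : ℝ) + 1)) x := by ring
    rw [this]
    refine (abs_add_le _ _).trans ?_
    rw [abs_mul, abs_mul, add_mul, mul_assoc]
    exact add_le_add
      (mul_le_mul (hb1 x) (abs_logCutoff_sub_one_le (hK k) x) (abs_nonneg _) hB1)
      (mul_le_mul (hb0 x) (hC _ (hK k) i x).1 (abs_nonneg _) hB0)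
  · obtain ⟨B1, hB1, hb1⟩ := (hφ.partialDeriv i).exists_bound
    obtain ⟨B2, hB2, hb2⟩ := ((hφ.partialDeriv i).partialDeriv i).exists_bound
    refine tendstoL2_of_abs_le hn (B2 + 2 * (B1 * C) + B0 * C) fun k x => ?_
    have e2 : partialDeriv i (partialDeriv i (fun x => logCutoff ((k : ℝ) + 1) x * φ x)) x =
        (logCutoff ((k : ℝ) + 1) x * partialDeriv i (partialDeriv i φ) x +
          partialDeriv i (logCutoff ((k : ℝ) + 1)) x * partialDeriv i φ x) +
        (partialDeriv i (logCutoff ((k : ℝ) + 1)) x * partialDeriv i φ x +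
          partialDeriv i (partialDeriv i (logCutoff ((k : ℝ) + 1))) x * φ x) := by
      rw [e1, partialDeriv_add i
        (by exact (hηd k x).mul (hφ.partialDeriv i).differentiableAt)
        (by exact (hηd' k i x).mul hφ.differentiableAt),
        partialDeriv_mul i (hηd k x) (hφ.partialDeriv i).differentiableAt,
        partialDeriv_mul i (hηd' k i x) hφ.differentiableAt]
    have : partialDeriv i (partialDeriv i (fun x => logCutoff ((k : ℝ) + 1) x * φ x)) x -
        partialDeriv i (partialDeriv i φ) x =
        partialDeriv i (partialDeriv i φ) x * (logCutoff ((k : ℝ) + 1) x - 1) +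
        2 * (partialDeriv i φ x * partialDeriv i (logCutoff ((k : ℝ) + 1)) x) +
        φ x * partialDeriv i (partialDeriv i (logCutoff ((k : ℝ) + 1))) x := by
      rw [e2]; ring
    rw [this]
    refine (abs_add_three _ _ _).trans ?_
    rw [abs_mul, abs_mul, abs_mul, abs_mul, add_mul, add_mul, abs_two, mul_assoc, mul_assoc,
      mul_assoc]
    refine add_le_add (add_le_add
      (mul_le_mul (hb2 x) (abs_logCutoff_sub_one_le (hK k) x) (abs_nonneg _) hB2)
      (mul_le_mul_of_nonneg_left ?_ zero_le_two))
      (mul_le_mul (hb0 x) (hC _ (hK k) i x).2 (abs_nonneg _) hB0)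
    exact mul_le_mul (hb1 x) (hC _ (hK k) i x).1 (abs_nonneg _) hB1

/-- Lower semicontinuity of weighted `L²` integrals against convergence in `L²`. -/
lemma lintegral_mul_sq_le_of_tendstoL2 {ι : Type*} [Fintype ι] {W : EuclideanSpace ℝ (Fin n) → ℝ}
    (hW : AEMeasurable W (volume.restrict Ω)) {w : ℕ → EuclideanSpace ℝ (Fin n) → ℝ}
    {v : EuclideanSpace ℝ (Fin n) → ℝ} {F : ℕ → ι → EuclideanSpace ℝ (Fin n) → ℝ}
    {G : ι → EuclideanSpace ℝ (Fin n) → ℝ}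
    (hw : ∀ k, AEStronglyMeasurable (w k) (volume.restrict Ω))
    (hv : AEStronglyMeasurable v (volume.restrict Ω))
    (hF : ∀ k i, AEStronglyMeasurable (F k i) (volume.restrict Ω))
    (hG : ∀ i, AEStronglyMeasurable (G i) (volume.restrict Ω))
    (hwv : TendstoL2 Ω w v) (hFG : ∀ i, TendstoL2 Ω (fun k => F k i) (G i))
    (h : ∀ k, ∫⁻ x in Ω, ENNReal.ofReal (W x * w k x ^ 2) ≤
      ∑ i, ∫⁻ x in Ω, ENNReal.ofReal (F k i x ^ 2)) :
    ∫⁻ x in Ω, ENNReal.ofReal (W x * v x ^ 2) ≤ ∑ i, ∫⁻ x in Ω, ENNReal.ofReal (G i x ^ 2) := by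
  -- Fatou along an almost everywhere convergent subsequence treats the left side, while the right
  -- side is controlled by norm convergence. `W` may be unbounded: finiteness of the limit is a
  -- conclusion.
  obtain ⟨ns, hns, hae⟩ := (tendstoInMeasure_of_tendsto_eLpNorm (by norm_num : (2 : ENNReal) ≠ 0)
    hw hv hwv).exists_seq_tendsto_ae
  have h1 : ∫⁻ x in Ω, ENNReal.ofReal (W x * v x ^ 2) ≤
      liminf (fun k => ∫⁻ x in Ω, ENNReal.ofReal (W x * w (ns k) x ^ 2)) atTop := by
    refine le_trans (le_of_eq ?_) (lintegral_liminf_le' fun k => ?_)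
    · refine lintegral_congr_ae ?_
      filter_upwards [hae] with x hx
      exact (ENNReal.tendsto_ofReal ((hx.pow 2).const_mul (W x))).liminf_eq.symm
    · exact (hW.mul ((hw (ns k)).aemeasurable.pow_const 2)).ennreal_ofReal
  have hlim : Tendsto (fun k => ∑ i, (eLpNorm (F (ns k) i - G i) 2 (volume.restrict Ω) +
      eLpNorm (G i) 2 (volume.restrict Ω)) ^ 2) atTop
      (𝓝 (∑ i, (0 + eLpNorm (G i) 2 (volume.restrict Ω)) ^ 2)) := by
    refine tendsto_finsetSum _ fun i _ => ?_
    refine ENNReal.Tendsto.pow ?_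
    exact ((hFG i).comp hns.tendsto_atTop).add tendsto_const_nhds
  refine h1.trans ?_
  have h2 : ∀ k, ∫⁻ x in Ω, ENNReal.ofReal (W x * w (ns k) x ^ 2) ≤
      ∑ i, (eLpNorm (F (ns k) i - G i) 2 (volume.restrict Ω) +
        eLpNorm (G i) 2 (volume.restrict Ω)) ^ 2 := by
    refine fun k => (h (ns k)).trans (Finset.sum_le_sum fun i _ => ?_)
    rw [← eLpNorm_two_sq]
    have h3 := eLpNorm_add_le ((hF (ns k) i).sub (hG i)) (hG i) (by norm_num : (1 : ENNReal) ≤ 2)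
    rw [sub_add_cancel] at h3
    gcongr
  refine (liminf_le_liminf (.of_forall h2)).trans ?_
  rw [hlim.liminf_eq]
  simp_rw [zero_add, eLpNorm_two_sq]
  exact le_rfl

end Approximation

/-! ### The best constant is at least one and is usable as a bound -/

section Beta

variable {n : ℕ} {R : ℝ} {P : ℝ → ℝ} {Ω : Set (EuclideanSpace ℝ (Fin n))}
  {u v : EuclideanSpace ℝ (Fin n) → ℝ}

lemma nontrivial_euclideanSpace (hn : 4 ≤ n) : Nontrivial (EuclideanSpace ℝ (Fin n)) := by
  refine ⟨⟨EuclideanSpace.single ⟨0, by omega⟩ 1, 0, ?_⟩⟩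
  simp

lemma setLIntegral_ofReal_eq {f : EuclideanSpace ℝ (Fin n) → ℝ} (hf : Integrable f)
    (h0 : ∀ x, 0 ≤ f x) (hΩ : ∀ x, x ∉ Ω → f x = 0) :
    ∫⁻ x in Ω, ENNReal.ofReal (f x) = ENNReal.ofReal (∫ x, f x) := by
  rw [← setIntegral_eq_integral_of_forall_compl_eq_zero hΩ,
    ofReal_integral_eq_lintegral_ofReal hf.integrableOn (.of_forall h0)]

lemma integrableOn_and_setIntegral_le {f : EuclideanSpace ℝ (Fin n) → ℝ} {b : ℝ} (hb : 0 ≤ b)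
    (hf : AEMeasurable f (volume.restrict Ω)) (h0 : 0 ≤ᵐ[volume.restrict Ω] f)
    (h : ∫⁻ x in Ω, ENNReal.ofReal (f x) ≤ ENNReal.ofReal b) :
    IntegrableOn f Ω ∧ ∫ x in Ω, f x ≤ b := by
  have hi : IntegrableOn f Ω := by
    refine ⟨hf.aestronglyMeasurable, ?_⟩
    rw [hasFiniteIntegral_iff_ofReal h0]
    exact h.trans_lt ENNReal.ofReal_lt_top
  refine ⟨hi, ?_⟩
  rw [← ofReal_integral_eq_lintegral_ofReal hi h0] at h
  exact (ENNReal.ofReal_le_ofReal_iff hb).1 h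

lemma ae_restrict_mem_puncturedBall (hn : 4 ≤ n) (hΩ : IsOpen Ω) (hΩR : Ω ⊆ Metric.ball 0 R) :
    ∀ᵐ x ∂(volume.restrict Ω), x ∈ puncturedBall n R := by
  have := nontrivial_euclideanSpace hn
  filter_upwards [ae_restrict_mem hΩ.measurableSet,
    ae_restrict_of_ae (compl_mem_ae_iff.2 (measure_singleton (0 : EuclideanSpace ℝ (Fin n))))]
    with x hx h0 using ⟨hΩR hx, h0⟩

lemma aemeasurable_radial (hn : 4 ≤ n) (hΩ : IsOpen Ω) (hΩR : Ω ⊆ Metric.ball 0 R) {g : ℝ → ℝ}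
    (hg : ContinuousOn g (Ioo 0 R)) :
    AEMeasurable (fun x : EuclideanSpace ℝ (Fin n) => g ‖x‖) (volume.restrict Ω) := by
  have h1 : AEMeasurable (fun x : EuclideanSpace ℝ (Fin n) => g ‖x‖)
      (volume.restrict (puncturedBall n R)) :=
    (continuousOn_radial hg).aemeasurable isOpen_puncturedBall.measurableSet
  have h2 : volume.restrict Ω = (volume.restrict Ω).restrict (puncturedBall n R) :=
    (Measure.restrict_eq_self_of_ae_mem (ae_restrict_mem_puncturedBall hn hΩ hΩR)).symm
  rw [h2, Measure.restrict_restrict isOpen_puncturedBall.measurableSet]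
  exact h1.mono_measure (Measure.restrict_mono inter_subset_left le_rfl)

lemma IsTestFunction.memLp (hv : IsTestFunction Ω v) : MemLp v 2 (volume.restrict Ω) :=
  (hv.continuous.memLp_of_hasCompactSupport hv.hasCompactSupport).restrict Ω

lemma tendstoL2_const (v : EuclideanSpace ℝ (Fin n) → ℝ) : TendstoL2 Ω (fun _ => v) v := by
  simp [TendstoL2]

lemma isH10_of_testFunction (hv : IsTestFunction Ω v) :
    IsH10 Ω v (fun i => partialDeriv i v) where
  memLp := hv.memLp
  memLp_grad i := (hv.partialDeriv i).memLp
  weak_grad i φ hφ := by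
    rw [setIntegral_eq_integral_of_forall_compl_eq_zero fun x hx => by
        simp [hv.eq_zero_of_notMem hx],
      setIntegral_eq_integral_of_forall_compl_eq_zero fun x hx => by
        simp [hφ.eq_zero_of_notMem hx]]
    exact integral_mul_partialDeriv i isOpen_univ (hv.contDiff.of_le (by simp)).contDiffOn
      (hφ.mono (subset_univ _))
  approx := ⟨fun _ => v, fun _ => hv, tendstoL2_const v, fun i => tendstoL2_const _⟩

lemma IsHIPotential.continuousOn_weight (hP : IsHIPotential P R) (c : ℝ) :
    ContinuousOn (fun r => c * (r ^ 2)⁻¹ + P r) (Ioo 0 R) :=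
  (continuousOn_const.mul (contDiffOn_inv_pow (m := 1) 2).continuousOn).add
    hP.contDiffOn.continuousOn

lemma IsHIPotential.lintegral_le_of_testFunction (hP : IsHIPotential P R)
    (hv : IsTestFunction (puncturedBall n R) v) :
    ∫⁻ x in Metric.ball 0 R,
      ENNReal.ofReal ((((n : ℝ) - 2) ^ 2 / 4 * (‖x‖ ^ 2)⁻¹ + P ‖x‖) * v x ^ 2) ≤
      ∑ i, ∫⁻ x in Metric.ball 0 R, ENNReal.ofReal (partialDeriv i v x ^ 2) := by
  have hsub : ∀ x : EuclideanSpace ℝ (Fin n), x ∉ Metric.ball 0 R → x ∉ puncturedBall n R :=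
    fun x hx h => hx h.1
  have id : ∀ i, Integrable fun x => partialDeriv i v x ^ 2 := fun i => by
    simpa [sq] using ((hv.partialDeriv i).mul (hv.partialDeriv i)).integrable
  rw [setLIntegral_ofReal_eq]
  · simp_rw [fun i => setLIntegral_ofReal_eq (Ω := Metric.ball 0 R) (id i)
      (fun x => sq_nonneg _) fun x hx => by
        simp [(hv.partialDeriv i).eq_zero_of_notMem (hsub x hx)]]
    rw [← ENNReal.ofReal_sum_of_nonneg fun i _ => integral_nonneg fun x => sq_nonneg _,
      ← integral_finsetSum _ fun i _ => id i]
    refine ENNReal.ofReal_le_ofReal ((hP.integral_le_integral_euler_sq hv).trans ?_)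
    refine integral_mono ?_ (integrable_finsetSum _ fun i _ => id i)
      fun x => inv_sq_norm_mul_euler_sq_le v x
    simpa [sq] using (hv.euler.mul hv.euler).integrable_inv_pow_mul 2
  · simp_rw [fun x => sq (v x)]
    exact (hv.mul hv).integrable_radial_mul (hP.continuousOn_weight (((n : ℝ) - 2) ^ 2 / 4))
  · intro x
    by_cases hx : x ∈ puncturedBall n R
    · have := hP.nonneg _ (norm_mem_Ioo_of_mem_puncturedBall hx)
      positivity
    · simp [hv.eq_zero_of_notMem hx]
  · intro x hx
    simp [hv.eq_zero_of_notMem (hsub x hx)]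

/-- The improved Hardy inequality with constant one on `H^1_0` of the ball. -/
lemma IsHIPotential.hardy_H10 (hn : 4 ≤ n) (hP : IsHIPotential P R)
    {Du : Fin n → EuclideanSpace ℝ (Fin n) → ℝ} (hu : IsH10 (Metric.ball 0 R) u Du) :
    IntegrableOn (fun x => P ‖x‖ * u x ^ 2) (Metric.ball 0 R) ∧
    ((n : ℝ) - 2) ^ 2 / 4 * (∫ x in Metric.ball 0 R, u x ^ 2 / ‖x‖ ^ 2) +
      ∫ x in Metric.ball 0 R, P ‖x‖ * u x ^ 2 ≤ ∫ x in Metric.ball 0 R, ∑ i, Du i x ^ 2 := by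
  set c : ℝ := ((n : ℝ) - 2) ^ 2 / 4 with hc
  have hn' : (4 : ℝ) ≤ n := by exact_mod_cast hn
  have hc0 : 0 < c := by
    have : 0 < (n : ℝ) - 2 := by linarith
    positivity
  have hball : IsOpen (Metric.ball (0 : EuclideanSpace ℝ (Fin n)) R) := Metric.isOpen_ball
  have hWm : AEMeasurable (fun x : EuclideanSpace ℝ (Fin n) => c * (‖x‖ ^ 2)⁻¹ + P ‖x‖)
      (volume.restrict (Metric.ball 0 R)) :=
    aemeasurable_radial hn hball subset_rfl (hP.continuousOn_weight c)
  have hPm : AEMeasurable (fun x : EuclideanSpace ℝ (Fin n) => P ‖x‖)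
      (volume.restrict (Metric.ball 0 R)) :=
    aemeasurable_radial hn hball subset_rfl hP.contDiffOn.continuousOn
  have htest : ∀ φ : EuclideanSpace ℝ (Fin n) → ℝ, IsTestFunction (Metric.ball 0 R) φ →
      ∫⁻ x in Metric.ball 0 R, ENNReal.ofReal ((c * (‖x‖ ^ 2)⁻¹ + P ‖x‖) * φ x ^ 2) ≤
      ∑ i, ∫⁻ x in Metric.ball 0 R, ENNReal.ofReal (partialDeriv i φ x ^ 2) := by
    intro φ hφ
    -- Only first derivatives matter here, so the `H²` approximation is more than enough.
    obtain ⟨ψ, hψ, h0, h1, -⟩ := exists_testFunction_approx_away_from_zero hn hφ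
    exact lintegral_mul_sq_le_of_tendstoL2 hWm
      (fun k => (hψ k).continuous.aestronglyMeasurable) hφ.continuous.aestronglyMeasurable
      (fun k i => ((hψ k).partialDeriv i).continuous.aestronglyMeasurable)
      (fun i => (hφ.partialDeriv i).continuous.aestronglyMeasurable) h0 h1
      fun k => hP.lintegral_le_of_testFunction (hψ k)
  obtain ⟨φ, hφ, h0, h1⟩ := hu.approx
  have hmain := lintegral_mul_sq_le_of_tendstoL2 hWm
    (fun k => (hφ k).continuous.aestronglyMeasurable) hu.memLp.aestronglyMeasurable
    (fun k i => ((hφ k).partialDeriv i).continuous.aestronglyMeasurable)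
    (fun i => (hu.memLp_grad i).aestronglyMeasurable) h0 h1 fun k => htest _ (hφ k)
  have iD : ∀ i, IntegrableOn (fun x => Du i x ^ 2) (Metric.ball 0 R) :=
    fun i => (hu.memLp_grad i).integrable_sq
  have hum := hu.memLp.aestronglyMeasurable.aemeasurable
  simp_rw [fun i => (ofReal_integral_eq_lintegral_ofReal (iD i)
    (.of_forall fun x => sq_nonneg (Du i x))).symm] at hmain
  rw [← ENNReal.ofReal_sum_of_nonneg fun i _ => integral_nonneg fun x => sq_nonneg _,
    ← integral_finsetSum _ fun i _ => iD i] at hmain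
  have hmem := ae_restrict_mem_puncturedBall hn hball 
    (subset_rfl : Metric.ball (0 : EuclideanSpace ℝ (Fin n)) R ⊆ _)
  obtain ⟨hi, hle⟩ := integrableOn_and_setIntegral_le
    (integral_nonneg fun x => Finset.sum_nonneg fun i _ => sq_nonneg _)
    (hWm.mul (hum.pow_const 2)) (by
      filter_upwards [hmem] with x hx
      have := hP.nonneg _ (norm_mem_Ioo_of_mem_puncturedBall hx)
      simp only [Pi.zero_apply, Pi.mul_apply]
      positivity) hmain
  have iP : IntegrableOn (fun x => P ‖x‖ * u x ^ 2) (Metric.ball 0 R) := by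
    refine hi.mono' (hPm.mul (hum.pow_const 2)).aestronglyMeasurable ?_
    filter_upwards [hmem] with x hx
    have := hP.nonneg _ (norm_mem_Ioo_of_mem_puncturedBall hx)
    rw [Real.norm_of_nonneg (by positivity)]
    simp only [Pi.mul_apply]
    gcongr
    exact le_add_of_nonneg_left (by positivity)
  refine ⟨iP, le_trans (le_of_eq ?_) hle⟩
  have iI : IntegrableOn (fun x => c * (u x ^ 2 / ‖x‖ ^ 2)) (Metric.ball 0 R) := by
    refine (hi.sub iP).congr (.of_forall fun x => ?_)
    simp only [Pi.sub_apply, Pi.mul_apply]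
    ring
  rw [← integral_const_mul, ← integral_add iI iP]
  refine integral_congr_ae (.of_forall fun x => ?_)
  simp only [Pi.mul_apply]
  ring

/-- This makes the denominators in `hardyBeta` genuine; integrability from `hardy_H10` rules out the
default value `0` of a divergent integral. -/
lemma setIntegral_potential_mul_sq_pos (hn : 4 ≤ n) (hP : IsHIPotential P R)
    (hPpos : ∀ r ∈ Ioo 0 R, 0 < P r)
    {Du : Fin n → EuclideanSpace ℝ (Fin n) → ℝ} (hu : IsH10 (Metric.ball 0 R) u Du)
    (hne : ¬ (u =ᵐ[volume.restrict (Metric.ball 0 R)] 0)) :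
    0 < ∫ x in Metric.ball 0 R, P ‖x‖ * u x ^ 2 := by
  have hmem := ae_restrict_mem_puncturedBall hn Metric.isOpen_ball
    (subset_rfl : Metric.ball (0 : EuclideanSpace ℝ (Fin n)) R ⊆ _)
  have h0 : 0 ≤ᵐ[volume.restrict (Metric.ball 0 R)] fun x => P ‖x‖ * u x ^ 2 := by
    filter_upwards [hmem] with x hx
    have := hP.nonneg _ (norm_mem_Ioo_of_mem_puncturedBall hx)
    simp only [Pi.zero_apply]
    positivity
  refine lt_of_le_of_ne (integral_nonneg_of_ae h0) fun h => hne ?_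
  have h1 := (integral_eq_zero_iff_of_nonneg_ae h0 (hP.hardy_H10 hn hu).1).1 h.symm
  filter_upwards [h1, hmem] with x hx hx2
  have := hPpos _ (norm_mem_Ioo_of_mem_puncturedBall hx2)
  simp only [Pi.zero_apply, mul_eq_zero, this.ne', false_or] at hx
  simpa using hx

/-- The set of Hardy quotients whose infimum is the best constant. -/
def hardyQuotients (n : ℕ) (P : ℝ → ℝ) (R : ℝ) : Set ℝ :=
  {q : ℝ | ∃ (u : EuclideanSpace ℝ (Fin n) → ℝ)
      (Du : Fin n → EuclideanSpace ℝ (Fin n) → ℝ),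
    IsH10 (Metric.ball 0 R) u Du ∧
    ¬ (u =ᵐ[volume.restrict (Metric.ball 0 R)] 0) ∧
    q = ((∫ x in Metric.ball (0 : EuclideanSpace ℝ (Fin n)) R, ∑ i, Du i x ^ 2)
          - ((n : ℝ) - 2) ^ 2 / 4 *
            ∫ x in Metric.ball (0 : EuclideanSpace ℝ (Fin n)) R, u x ^ 2 / ‖x‖ ^ 2)
        / ∫ x in Metric.ball (0 : EuclideanSpace ℝ (Fin n)) R, P ‖x‖ * u x ^ 2}

lemma hardyBeta_eq_sInf : hardyBeta n P R = sInf (hardyQuotients n P R) := rfl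

lemma one_le_of_mem_hardyQuotients (hn : 4 ≤ n) (hP : IsHIPotential P R)
    (hPpos : ∀ r ∈ Ioo 0 R, 0 < P r) {q : ℝ} (hq : q ∈ hardyQuotients n P R) : 1 ≤ q := by
  obtain ⟨u, Du, hu, hne, rfl⟩ := hq
  rw [one_le_div (setIntegral_potential_mul_sq_pos hn hP hPpos hu hne)]
  linarith [(hP.hardy_H10 hn hu).2]

/-- Without a lower bound the real `sInf` would take its default value `0` and not bound the
quotients. -/
lemma bddBelow_hardyQuotients (hn : 4 ≤ n) (hP : IsHIPotential P R)
    (hPpos : ∀ r ∈ Ioo 0 R, 0 < P r) : BddBelow (hardyQuotients n P R) :=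
  ⟨1, fun _ hq => one_le_of_mem_hardyQuotients hn hP hPpos hq⟩

lemma one_le_hardyBeta (hn : 4 ≤ n) (hR : 0 < R) (hP : IsHIPotential P R)
    (hPpos : ∀ r ∈ Ioo 0 R, 0 < P r) : 1 ≤ hardyBeta n P R := by
  rw [hardyBeta_eq_sInf]
  refine le_csInf ?_ fun q hq => one_le_of_mem_hardyQuotients hn hP hPpos hq
  -- The real `sInf` of the empty set is `0`, so a competitor is required: a bump function equal to
  -- `1` at the centre.
  obtain ⟨g, hg1, hg2, hg3, -, hg5⟩ := exists_contDiff_tsupport_subset (n := ⊤)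
    (Metric.ball_mem_nhds (0 : EuclideanSpace ℝ (Fin n)) hR)
  have hg : IsTestFunction (Metric.ball 0 R) g := ⟨hg3, hg2, hg1⟩
  refine ⟨_, g, _, isH10_of_testFunction hg, fun h => ?_, rfl⟩
  have h1 : EqOn g 0 (Metric.ball 0 R) :=
    Measure.eqOn_open_of_ae_eq h Metric.isOpen_ball hg.continuous.continuousOn continuousOn_const
  have := h1 (Metric.mem_ball_self hR)
  simp [hg5] at this

/-- A single integral is used because `integral_nonneg_of_forall_radial` asks for this form on each
radial slice. -/
lemma hardyBeta_mul_le (hn : 4 ≤ n) (hP : IsHIPotential P R)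
    (hPpos : ∀ r ∈ Ioo 0 R, 0 < P r)
    (hv : IsTestFunction (puncturedBall n R) v) :
    0 ≤ ∫ x, ((∑ i, partialDeriv i v x ^ 2) -
      (((n : ℝ) - 2) ^ 2 / 4 * ((‖x‖ ^ 2)⁻¹ * v x ^ 2) +
        hardyBeta n P R * (P ‖x‖ * v x ^ 2))) := by
  have i0 : Integrable fun x => ∑ i, partialDeriv i v x ^ 2 := by
    refine integrable_finsetSum _ fun i _ => ?_
    simpa [sq] using ((hv.partialDeriv i).mul (hv.partialDeriv i)).integrable
  have i1 : Integrable fun x => (‖x‖ ^ 2)⁻¹ * v x ^ 2 := by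
    simpa [sq] using (hv.mul hv).integrable_inv_pow_mul 2
  have i2 : Integrable fun x => P ‖x‖ * v x ^ 2 := by
    simpa [sq] using (hv.mul hv).integrable_radial_mul hP.contDiffOn.continuousOn
  have i3 : Integrable fun x => ((n : ℝ) - 2) ^ 2 / 4 * ((‖x‖ ^ 2)⁻¹ * v x ^ 2) := i1.const_mul _
  have i4 : Integrable fun x => hardyBeta n P R * (P ‖x‖ * v x ^ 2) := i2.const_mul _
  rw [integral_sub i0 (by exact i3.add i4), integral_add i3 i4, integral_const_mul,
    integral_const_mul]
  have hvz : ∀ x : EuclideanSpace ℝ (Fin n), x ∉ Metric.ball 0 R → x ∉ puncturedBall n R :=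
    fun x hx h => hx h.1
  have r0 := setIntegral_eq_integral_of_forall_compl_eq_zero (μ := volume) (s := Metric.ball 0 R)
    (f := fun x => ∑ i, partialDeriv i v x ^ 2)
    fun x hx => by simp [(hv.partialDeriv _).eq_zero_of_notMem (hvz x hx)]
  have r1 := setIntegral_eq_integral_of_forall_compl_eq_zero (μ := volume) (s := Metric.ball 0 R)
    (f := fun x => (‖x‖ ^ 2)⁻¹ * v x ^ 2)
    fun x hx => by simp [hv.eq_zero_of_notMem (hvz x hx)]
  have r2 := setIntegral_eq_integral_of_forall_compl_eq_zero (μ := volume) (s := Metric.ball 0 R)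
    (f := fun x => P ‖x‖ * v x ^ 2)
    fun x hx => by simp [hv.eq_zero_of_notMem (hvz x hx)]
  -- A vanishing `v` is not admitted in the infimum.
  by_cases hz : v =ᵐ[volume.restrict (Metric.ball 0 R)] 0
  · have z1 : ∫ x, (‖x‖ ^ 2)⁻¹ * v x ^ 2 = 0 := by
      rw [← r1]
      refine integral_eq_zero_of_ae ?_
      filter_upwards [hz] with x hx
      simp [hx]
    have z2 : ∫ x, P ‖x‖ * v x ^ 2 = 0 := by
      rw [← r2]
      refine integral_eq_zero_of_ae ?_
      filter_upwards [hz] with x hx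
      simp [hx]
    rw [z1, z2]
    simpa using integral_nonneg fun x => Finset.sum_nonneg fun i _ => sq_nonneg _
  · have hH := isH10_of_testFunction
      (hv.mono (fun x hx => hx.1 : puncturedBall n R ⊆ Metric.ball 0 R))
    have hpos := setIntegral_potential_mul_sq_pos hn hP hPpos hH hz
    have hle : hardyBeta n P R ≤ _ := csInf_le (bddBelow_hardyQuotients hn hP hPpos)
      ⟨v, _, hH, hz, rfl⟩
    rw [le_div_iff₀ hpos] at hle
    simp_rw [div_eq_inv_mul] at hle r1 ⊢
    rw [r0, r1, r2] at hle
    linarith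

end Beta

/-! ### The Hardy inequality for the radial derivative, and Hardy–Rellich off the origin -/

section RadialHardy

variable {n : ℕ} {R : ℝ} {P : ℝ → ℝ} {u v : EuclideanSpace ℝ (Fin n) → ℝ}
  {ξ : EuclideanSpace ℝ (Fin n)}

/-- The norm is not smooth at the origin, but the slice vanishes near it. -/
lemma IsTestFunction.radialSlice (hv : IsTestFunction (puncturedBall n R) v) (hξ : ‖ξ‖ = 1) :
    IsTestFunction (puncturedBall n R) (fun x => v (‖x‖ • ξ)) := by
  have hcont : Continuous fun x : EuclideanSpace ℝ (Fin n) => ‖x‖ • ξ := by fun_prop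
  have hsub : tsupport (fun x => v (‖x‖ • ξ)) ⊆ {x | ‖x‖ • ξ ∈ tsupport v} :=
    closure_minimal (fun x hx => subset_tsupport v hx) ((isClosed_tsupport v).preimage hcont)
  have hsub2 : {x | ‖x‖ • ξ ∈ tsupport v} ⊆ puncturedBall n R := by
    intro x hx
    have := norm_mem_Ioo_of_mem_puncturedBall (hv.2.2 hx)
    rw [norm_smul, hξ, norm_norm, mul_one] at this
    exact ⟨by simpa using this.2, norm_pos_iff.1 this.1⟩
  refine ⟨?_, ?_, hsub.trans hsub2⟩
  · rw [← contMDiff_iff_contDiff]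
    refine contMDiff_of_tsupport fun x hx => ContDiffAt.contMDiffAt ?_
    have hx0 : x ≠ 0 := (hsub2 (hsub hx)).2
    exact hv.1.contDiffAt.comp x ((contDiffAt_norm ℝ hx0).smul contDiffAt_const)
  · exact Metric.isCompact_of_isClosed_isBounded (isClosed_tsupport _)
      (Metric.isBounded_ball.subset ((hsub.trans hsub2).trans sdiff_subset))

lemma sum_partialDeriv_radialSlice_sq (hv : IsTestFunction (puncturedBall n R) v)
    (hξ : ‖ξ‖ = 1) (x : EuclideanSpace ℝ (Fin n)) :
    ∑ i, partialDeriv i (fun x => v (‖x‖ • ξ)) x ^ 2 =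
      (‖x‖ ^ 2)⁻¹ * euler v (‖x‖ • ξ) ^ 2 := by
  rcases eq_or_ne x 0 with rfl | hx
  · have h0 : (0 : EuclideanSpace ℝ (Fin n)) ∉ puncturedBall n R := fun h => h.2 rfl
    simp [((hv.radialSlice hξ).partialDeriv _).eq_zero_of_notMem h0]
  · have hx0 : ‖x‖ ≠ 0 := norm_ne_zero_iff.2 hx
    have hd : HasDerivAt (fun r : ℝ => v (r • ξ)) (fderiv ℝ v (‖x‖ • ξ) ξ) ‖x‖ := by
      have h1 : HasDerivAt (fun r : ℝ => r • ξ) ξ ‖x‖ := by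
        simpa using (hasDerivAt_id ‖x‖).smul_const ξ
      exact (hv.differentiableAt (x := ‖x‖ • ξ)).hasFDerivAt.comp_hasDerivAt ‖x‖ h1
    simp_rw [fun i => partialDeriv_radial (g := fun r => v (r • ξ)) i hx hd.differentiableAt,
      hd.deriv, mul_pow]
    rw [← Finset.mul_sum, ← EuclideanSpace.real_norm_sq_eq]
    simp only [euler, map_smul, smul_eq_mul]
    field_simp

/-- The improved Hardy inequality for the radial derivative alone. -/
lemma hardyBeta_radial (hn : 4 ≤ n) (hP : IsHIPotential P R)
    (hPpos : ∀ r ∈ Ioo 0 R, 0 < P r) (hv : IsTestFunction (puncturedBall n R) v) :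
    ((n : ℝ) - 2) ^ 2 / 4 * (∫ x, (‖x‖ ^ 2)⁻¹ * v x ^ 2) +
      hardyBeta n P R * (∫ x, P ‖x‖ * v x ^ 2) ≤ ∫ x, (‖x‖ ^ 2)⁻¹ * euler v x ^ 2 := by
  have : NeZero n := ⟨by omega⟩
  have i0 : Integrable fun x => (‖x‖ ^ 2)⁻¹ * euler v x ^ 2 := by
    simpa [sq] using (hv.euler.mul hv.euler).integrable_inv_pow_mul 2
  have i1 : Integrable fun x => (‖x‖ ^ 2)⁻¹ * v x ^ 2 := by
    simpa [sq] using (hv.mul hv).integrable_inv_pow_mul 2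
  have i2 : Integrable fun x => P ‖x‖ * v x ^ 2 := by
    simpa [sq] using (hv.mul hv).integrable_radial_mul hP.contDiffOn.continuousOn
  have hnn : 0 ≤ ∫ x, ((‖x‖ ^ 2)⁻¹ * euler v x ^ 2 +
      (-(((n : ℝ) - 2) ^ 2 / 4)) * ((‖x‖ ^ 2)⁻¹ * v x ^ 2) +
      (-hardyBeta n P R) * (P ‖x‖ * v x ^ 2)) := by
    -- Each slice is a radial competitor for `β`, and its full gradient squared is `|x|⁻² (Ev)²` on
    -- the ray.
    refine integral_nonneg_of_forall_radial ((i0.add (i1.const_mul _)).add (i2.const_mul _))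
      fun ξ hξ => ?_
    refine (hardyBeta_mul_le hn hP hPpos (hv.radialSlice hξ)).trans_eq ?_
    refine integral_congr_ae (.of_forall fun x => ?_)
    simp only [sum_partialDeriv_radialSlice_sq hv hξ, norm_smul, hξ, norm_norm, mul_one]
    ring
  rw [integral_add_const_mul_add_const_mul i0 i1 i2] at hnn
  linarith

/-- Since `E(v/|x|) = (Ev - v)/|x|`, this is `hardyBeta_radial` for `v/|x|`. -/
lemma hardyBeta_radial_weighted (hn : 4 ≤ n) (hP : IsHIPotential P R)
    (hPpos : ∀ r ∈ Ioo 0 R, 0 < P r) (hv : IsTestFunction (puncturedBall n R) v) :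
    ((n : ℝ) - 2) ^ 2 / 4 * (∫ x, (‖x‖ ^ 4)⁻¹ * v x ^ 2) +
      hardyBeta n P R * (∫ x, (P ‖x‖ * (‖x‖ ^ 2)⁻¹) * v x ^ 2) ≤
      ∫ x, (‖x‖ ^ 4)⁻¹ * (euler v x - v x) ^ 2 := by
  have h := hardyBeta_radial hn hP hPpos (hv.inv_pow_mul 1)
  have he : ∀ x, (‖x‖ ^ 2)⁻¹ * euler (fun y => (‖y‖ ^ 1)⁻¹ * v y) x ^ 2 =
      (‖x‖ ^ 4)⁻¹ * (euler v x - v x) ^ 2 := by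
    intro x
    by_cases hx : x ∈ puncturedBall n R
    · have hx0 : ‖x‖ ≠ 0 := norm_ne_zero_iff.2 hx.2
      have hd := hasDerivAt_inv_pow 1 hx0
      rw [euler_mul (differentiableAt_inv_pow_norm 1 hx.2) hv.differentiableAt,
        euler_radial (g := fun r => (r ^ 1)⁻¹) hx.2 hd.differentiableAt, hd.deriv]
      field_simp
      push_cast
      ring
    · rw [(hv.inv_pow_mul 1).euler.eq_zero_of_notMem hx, hv.euler.eq_zero_of_notMem hx,
        hv.eq_zero_of_notMem hx]
      simp
  have h1 : ∀ x, (‖x‖ ^ 2)⁻¹ * ((‖x‖ ^ 1)⁻¹ * v x) ^ 2 = (‖x‖ ^ 4)⁻¹ * v x ^ 2 := fun x => by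
    rw [pow_one, mul_pow, ← mul_assoc, inv_pow, ← mul_inv, ← pow_add]
  have h2 : ∀ x, P ‖x‖ * ((‖x‖ ^ 1)⁻¹ * v x) ^ 2 = (P ‖x‖ * (‖x‖ ^ 2)⁻¹) * v x ^ 2 := fun x => by
    rw [pow_one, mul_pow, ← mul_assoc, inv_pow]
  simp_rw [he, h1, h2] at h
  exact h

/-- The improved Hardy-Rellich inequality away from the origin. -/
lemma hardyRellich_of_testFunction (hn : 4 ≤ n) (hR : 0 < R) {lam : ℝ} {f : ℝ → ℝ}
    (hlam : lam < (n : ℝ) - 2) (hP : IsHIPotential P R) (hPpos : ∀ r ∈ Ioo 0 R, 0 < P r)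
    (hPf : ∀ r ∈ Ioo 0 R, deriv P r / P r = -lam / r + f r)
    (hf : ∀ r ∈ Ioo 0 R, 0 ≤ f r) (hu : IsTestFunction (puncturedBall n R) u) :
    (n : ℝ) ^ 2 * ((n : ℝ) - 4) ^ 2 / 16 * (∫ x, (‖x‖ ^ 4)⁻¹ * u x ^ 2) +
      hardyBeta n P R * ((n : ℝ) ^ 2 + ((n : ℝ) - lam - 2) ^ 2) / 4 *
        (∫ x, (P ‖x‖ * (‖x‖ ^ 2)⁻¹) * u x ^ 2) ≤
      ∫ x, (∑ i, partialDeriv i (partialDeriv i u) x) ^ 2 := by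
  have hβ := one_le_hardyBeta hn hR hP hPpos
  have h1 := integral_radialLaplacian_sq_le hn hu
  rw [integral_radialLaplacian_sq hu] at h1
  -- Together with the term `n - 1` in `h1`, the constant becomes `(n-2)²/4 + (n-1) = n²/4`.
  have h2 := hardyBeta_radial_weighted hn hP hPpos hu.euler
  have h3 := hardyBeta_radial_weighted hn hP hPpos hu
  have h4 := integral_potential_mul_sq_le hlam hP.contDiffOn hPpos hPf hf hu
  have h5 := integral_inv_pow_mul_mul_euler 4 hu
  have i0 : Integrable fun x => (‖x‖ ^ 4)⁻¹ * u x ^ 2 := by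
    simpa [sq] using (hu.mul hu).integrable_inv_pow_mul 4
  have i1 := (hu.mul hu.euler).integrable_inv_pow_mul 4
  have i2 : Integrable fun x => (‖x‖ ^ 4)⁻¹ * euler u x ^ 2 := by
    simpa [sq] using (hu.euler.mul hu.euler).integrable_inv_pow_mul 4
  have hexp : ∀ x, (‖x‖ ^ 4)⁻¹ * (euler u x - u x) ^ 2 = (‖x‖ ^ 4)⁻¹ * euler u x ^ 2 +
      (-2) * ((‖x‖ ^ 4)⁻¹ * (u x * euler u x)) + 1 * ((‖x‖ ^ 4)⁻¹ * u x ^ 2) := fun x => by ring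
  simp_rw [hexp] at h3
  rw [integral_add_const_mul_add_const_mul i2 i1 i0, h5] at h3
  push_cast at h3
  set I := ∫ x, (‖x‖ ^ 4)⁻¹ * u x ^ 2
  set J := ∫ x, (P ‖x‖ * (‖x‖ ^ 2)⁻¹) * u x ^ 2
  set E := ∫ x, (‖x‖ ^ 4)⁻¹ * euler u x ^ 2
  set F := ∫ x, (P ‖x‖ * (‖x‖ ^ 2)⁻¹) * euler u x ^ 2
  -- Expanding `(Eu - u)²` contributes `(n-3) I`, and `(n-2)²/4 - (n-3) = (n-4)²/4`.
  have h3' : ((n : ℝ) - 4) ^ 2 / 4 * I + hardyBeta n P R * J ≤ E := by linarith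
  have h6 : (n : ℝ) ^ 2 / 4 * (((n : ℝ) - 4) ^ 2 / 4 * I + hardyBeta n P R * J) ≤
      (n : ℝ) ^ 2 / 4 * E := mul_le_mul_of_nonneg_left h3' (by positivity)
  have h7 := mul_le_mul_of_nonneg_left h4 (zero_le_one.trans hβ)
  linarith

end RadialHardy

/-! ### Passage from test functions off the origin to `H^2_0` -/

section Sobolev

variable {n : ℕ} {Ω : Set (EuclideanSpace ℝ (Fin n))}

lemma TendstoL2.sum {ι : Type*} (s : Finset ι) {w : ℕ → ι → EuclideanSpace ℝ (Fin n) → ℝ}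
    {v : ι → EuclideanSpace ℝ (Fin n) → ℝ}
    (hw : ∀ k, ∀ i ∈ s, AEStronglyMeasurable (w k i) (volume.restrict Ω))
    (hv : ∀ i ∈ s, AEStronglyMeasurable (v i) (volume.restrict Ω))
    (h : ∀ i ∈ s, TendstoL2 Ω (fun k => w k i) (v i)) :
    TendstoL2 Ω (fun k x => ∑ i ∈ s, w k i x) (fun x => ∑ i ∈ s, v i x) := by
  have hlim : Tendsto (fun k => ∑ i ∈ s, eLpNorm (w k i - v i) 2 (volume.restrict Ω)) atTop
      (𝓝 (∑ i ∈ s, 0)) := tendsto_finsetSum _ h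
  rw [Finset.sum_const_zero] at hlim
  refine tendsto_of_tendsto_of_tendsto_of_le_of_le tendsto_const_nhds hlim (fun _ => zero_le)
    fun k => ?_
  have he : ((fun x => ∑ i ∈ s, w k i x) - fun x => ∑ i ∈ s, v i x) = ∑ i ∈ s, (w k i - v i) := by
    ext x
    simp [Finset.sum_sub_distrib]
  simp only [he]
  exact eLpNorm_sum_le (fun i hi => (hw k i hi).sub (hv i hi)) (by norm_num)

lemma memLp_sum_diag {D2u : Fin n → Fin n → EuclideanSpace ℝ (Fin n) → ℝ}
    (h : ∀ i j, MemLp (D2u i j) 2 (volume.restrict Ω)) :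
    MemLp (fun x => ∑ i, D2u i i x) 2 (volume.restrict Ω) :=
  memLp_finsetSum _ fun i _ => h i i

/-- Weighted inequalities for the Laplacian extend from test functions supported away from the
origin to `H^2_0`. -/
lemma IsH20.lintegral_le (hn : 4 ≤ n) {u : EuclideanSpace ℝ (Fin n) → ℝ}
    {Du : Fin n → EuclideanSpace ℝ (Fin n) → ℝ}
    {D2u : Fin n → Fin n → EuclideanSpace ℝ (Fin n) → ℝ} (hu : IsH20 Ω u Du D2u)
    {W : EuclideanSpace ℝ (Fin n) → ℝ} (hW : AEMeasurable W (volume.restrict Ω))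
    (h : ∀ ψ : EuclideanSpace ℝ (Fin n) → ℝ, IsTestFunction (Ω \ {0}) ψ →
      ∫⁻ x in Ω, ENNReal.ofReal (W x * ψ x ^ 2) ≤
        ∫⁻ x in Ω, ENNReal.ofReal ((∑ i, partialDeriv i (partialDeriv i ψ) x) ^ 2)) :
    ∫⁻ x in Ω, ENNReal.ofReal (W x * u x ^ 2) ≤
      ∫⁻ x in Ω, ENNReal.ofReal ((∑ i, D2u i i x) ^ 2) := by
  have hm : ∀ (U : Set (EuclideanSpace ℝ (Fin n))) (φ : EuclideanSpace ℝ (Fin n) → ℝ),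
      IsTestFunction U φ → ∀ i,
      AEStronglyMeasurable (partialDeriv i (partialDeriv i φ)) (volume.restrict Ω) :=
    fun U φ hφ i => ((hφ.partialDeriv i).partialDeriv i).continuous.aestronglyMeasurable
  have hs : ∀ (U : Set (EuclideanSpace ℝ (Fin n))) (φ : EuclideanSpace ℝ (Fin n) → ℝ),
      IsTestFunction U φ → AEStronglyMeasurable
        (fun x => ∑ i, partialDeriv i (partialDeriv i φ) x) (volume.restrict Ω) :=
    fun U φ hφ => (IsTestFunction.sum _ fun i _ =>
      (hφ.partialDeriv i).partialDeriv i).continuous.aestronglyMeasurable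
  have htest : ∀ φ : EuclideanSpace ℝ (Fin n) → ℝ, IsTestFunction Ω φ →
      ∫⁻ x in Ω, ENNReal.ofReal (W x * φ x ^ 2) ≤
        ∫⁻ x in Ω, ENNReal.ofReal ((∑ i, partialDeriv i (partialDeriv i φ) x) ^ 2) := by
    intro φ hφ
    obtain ⟨ψ, hψ, h0, -, h2⟩ := exists_testFunction_approx_away_from_zero hn hφ
    -- The right side is the square of one function, the Laplacian, hence the one-point index type.
    have := lintegral_mul_sq_le_of_tendstoL2 (ι := Unit) hW
      (fun k => (hψ k).continuous.aestronglyMeasurable) hφ.continuous.aestronglyMeasurable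
      (fun k _ => hs _ _ (hψ k)) (fun _ => hs _ _ hφ) h0
      (fun _ => TendstoL2.sum _ (fun k i _ => hm _ _ (hψ k) i) (fun i _ => hm _ _ hφ i)
        fun i _ => h2 i)
      fun k => by simpa using h _ (hψ k)
    simpa using this
  obtain ⟨φ, hφ, h0, -, h2⟩ := hu.approx
  have := lintegral_mul_sq_le_of_tendstoL2 (ι := Unit) hW
    (fun k => (hφ k).continuous.aestronglyMeasurable) hu.memLp.aestronglyMeasurable
    (fun k _ => hs _ _ (hφ k)) (fun _ => (memLp_sum_diag hu.memLp_hess).aestronglyMeasurable) h0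
    (fun _ => TendstoL2.sum _ (fun k i _ => hm _ _ (hφ k) i)
      (fun i _ => (hu.memLp_hess i i).aestronglyMeasurable) fun i _ => h2 i i)
    fun k => by simpa using htest _ (hφ k)
  simpa using this

end Sobolev

/-! ### The Hardy–Rellich inequality on `H^2_0` -/

theorem mainTheorem4 (n : ℕ) (hn : 4 ≤ n) (lam : ℝ) (hlam : lam < (n : ℝ) - 2)
    (R : ℝ) (hR : 0 < R) (P f : ℝ → ℝ) (hP : IsHIPotential P R)
    (hPpos : ∀ r ∈ Ioo 0 R, 0 < P r)
    (hPf : ∀ r ∈ Ioo 0 R, deriv P r / P r = -lam / r + f r)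
    (hf : ∀ r ∈ Ioo 0 R, 0 ≤ f r)
    (hf0 : Tendsto (fun r => r * f r) (𝓝[>] 0) (𝓝 0))
    (Ω : Set (EuclideanSpace ℝ (Fin n))) (hΩ : IsOpen Ω) (h0 : 0 ∈ Ω)
    (hΩR : Ω ⊆ Metric.ball 0 R)
    (u : EuclideanSpace ℝ (Fin n) → ℝ) (Du : Fin n → EuclideanSpace ℝ (Fin n) → ℝ)
    (D2u : Fin n → Fin n → EuclideanSpace ℝ (Fin n) → ℝ) (hu : IsH20 Ω u Du D2u) :
    IntegrableOn (fun x => (∑ i, D2u i i x) ^ 2) Ω ∧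
    (n ≠ 4 → IntegrableOn (fun x => u x ^ 2 / ‖x‖ ^ 4) Ω) ∧
    IntegrableOn (fun x => P ‖x‖ / ‖x‖ ^ 2 * u x ^ 2) Ω ∧
    (n : ℝ) ^ 2 * ((n : ℝ) - 4) ^ 2 / 16 * (∫ x in Ω, u x ^ 2 / ‖x‖ ^ 4)
        + hardyBeta n P R * ((n : ℝ) ^ 2 + ((n : ℝ) - lam - 2) ^ 2) / 4 *
          (∫ x in Ω, P ‖x‖ / ‖x‖ ^ 2 * u x ^ 2)
      ≤ ∫ x in Ω, (∑ i, D2u i i x) ^ 2 := by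
  have hβ := one_le_hardyBeta hn hR hP hPpos
  have hn' : (4 : ℝ) ≤ n := by exact_mod_cast hn
  have hrellich := fun ψ (hψ : IsTestFunction (puncturedBall n R) ψ) =>
    hardyRellich_of_testFunction hn hR hlam hP hPpos hPf hf hψ
  set a : ℝ := (n : ℝ) ^ 2 * ((n : ℝ) - 4) ^ 2 / 16 with ha
  set b : ℝ := hardyBeta n P R * ((n : ℝ) ^ 2 + ((n : ℝ) - lam - 2) ^ 2) / 4 with hb
  have ha0 : 0 ≤ a := by positivity
  have hb0 : 0 < b := by
    have : 0 < hardyBeta n P R := by linarith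
    positivity
  have hΔ : IntegrableOn (fun x => (∑ i, D2u i i x) ^ 2) Ω :=
    (memLp_sum_diag hu.memLp_hess).integrable_sq
  have c1 : ContinuousOn (fun r : ℝ => (r ^ 4)⁻¹) (Ioo 0 R) :=
    (contDiffOn_inv_pow (m := 1) 4).continuousOn
  have c2 : ContinuousOn (fun r : ℝ => P r * (r ^ 2)⁻¹) (Ioo 0 R) :=
    hP.contDiffOn.continuousOn.mul (contDiffOn_inv_pow (m := 1) 2).continuousOn
  have cW : ContinuousOn (fun r : ℝ => a * (r ^ 4)⁻¹ + b * (P r * (r ^ 2)⁻¹)) (Ioo 0 R) :=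
    (continuousOn_const.mul c1).add (continuousOn_const.mul c2)
  have hWm := aemeasurable_radial hn hΩ hΩR cW
  have hW0 : ∀ x ∈ puncturedBall n R,
      0 ≤ a * (‖x‖ ^ 4)⁻¹ + b * (P ‖x‖ * (‖x‖ ^ 2)⁻¹) := fun x hx => by
    have := hPpos _ (norm_mem_Ioo_of_mem_puncturedBall hx)
    positivity
  -- Both lower-order terms are kept in one nonnegative weight, so a single limit passage serves the
  -- inequality and all the integrability claims.
  have hmain := hu.lintegral_le hn hWm fun ψ hψ => by
    have hψΩ : ∀ x, x ∉ Ω → ψ x = 0 := fun x hx => hψ.eq_zero_of_notMem fun h => hx h.1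
    have hψ' : IsTestFunction (puncturedBall n R) ψ := hψ.mono fun x hx => ⟨hΩR hx.1, hx.2⟩
    have i1 : Integrable fun x => (‖x‖ ^ 4)⁻¹ * ψ x ^ 2 := by
      simpa [sq] using (hψ'.mul hψ').integrable_inv_pow_mul 4
    have i2 : Integrable fun x => (P ‖x‖ * (‖x‖ ^ 2)⁻¹) * ψ x ^ 2 := by
      simp_rw [fun x => sq (ψ x)]
      exact (hψ'.mul hψ').integrable_radial_mul c2
    have j1 : Integrable fun x => a * ((‖x‖ ^ 4)⁻¹ * ψ x ^ 2) := i1.const_mul a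
    have j2 : Integrable fun x => b * ((P ‖x‖ * (‖x‖ ^ 2)⁻¹) * ψ x ^ 2) := i2.const_mul b
    have hsplit : ∀ x, (a * (‖x‖ ^ 4)⁻¹ + b * (P ‖x‖ * (‖x‖ ^ 2)⁻¹)) * ψ x ^ 2 =
        a * ((‖x‖ ^ 4)⁻¹ * ψ x ^ 2) + b * ((P ‖x‖ * (‖x‖ ^ 2)⁻¹) * ψ x ^ 2) := fun x => by ring
    have tL : IsTestFunction (Ω \ {0}) fun x => ∑ i, partialDeriv i (partialDeriv i ψ) x :=
      IsTestFunction.sum _ fun i _ => (hψ.partialDeriv i).partialDeriv i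
    rw [setLIntegral_ofReal_eq, setLIntegral_ofReal_eq]
    · refine ENNReal.ofReal_le_ofReal ?_
      simp_rw [hsplit]
      rw [integral_add j1 j2, integral_const_mul, integral_const_mul]
      exact hrellich ψ hψ'
    · simpa [sq] using (tL.mul tL).integrable
    · exact fun x => sq_nonneg _
    · exact fun x hx => by simp [tL.eq_zero_of_notMem fun h => hx h.1]
    · simp_rw [hsplit]
      exact j1.add j2
    · intro x
      by_cases hx : x ∈ puncturedBall n R
      · exact mul_nonneg (hW0 x hx) (sq_nonneg _)
      · simp [hψ'.eq_zero_of_notMem hx]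
    · exact fun x hx => by simp [hψΩ x hx]
  rw [← ofReal_integral_eq_lintegral_ofReal hΔ (.of_forall fun x => sq_nonneg _)] at hmain
  have hum := hu.memLp.aestronglyMeasurable.aemeasurable
  have hmem := ae_restrict_mem_puncturedBall hn hΩ hΩR
  obtain ⟨hi, hle⟩ := integrableOn_and_setIntegral_le (integral_nonneg fun x => sq_nonneg _)
    (hWm.mul (hum.pow_const 2)) (by
      filter_upwards [hmem] with x hx
      exact mul_nonneg (hW0 x hx) (sq_nonneg _)) hmain
  have iP : IntegrableOn (fun x => P ‖x‖ / ‖x‖ ^ 2 * u x ^ 2) Ω := by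
    have hm : AEMeasurable (fun x => P ‖x‖ / ‖x‖ ^ 2 * u x ^ 2) (volume.restrict Ω) := by
      simp_rw [div_eq_mul_inv]
      exact (aemeasurable_radial hn hΩ hΩR c2).mul (hum.pow_const 2)
    -- As `a ≥ 0` and `b > 0`, the potential term is at most `b⁻¹` times the whole weighted
    -- integrand.
    refine (hi.const_mul b⁻¹).mono' hm.aestronglyMeasurable ?_
    filter_upwards [hmem] with x hx
    have := hPpos _ (norm_mem_Ioo_of_mem_puncturedBall hx)
    rw [Real.norm_of_nonneg (by positivity)]
    have e : b⁻¹ * ((a * (‖x‖ ^ 4)⁻¹ + b * (P ‖x‖ * (‖x‖ ^ 2)⁻¹)) * u x ^ 2) =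
        P ‖x‖ / ‖x‖ ^ 2 * u x ^ 2 + b⁻¹ * (a * (‖x‖ ^ 4)⁻¹ * u x ^ 2) := by
      have hbb : b⁻¹ * b = 1 := inv_mul_cancel₀ hb0.ne'
      linear_combination (P ‖x‖ * (‖x‖ ^ 2)⁻¹ * u x ^ 2) * hbb
    simp only [Pi.mul_apply]
    rw [e]
    exact le_add_of_nonneg_right (by positivity)
  -- The factor `a` stays inside: for `n = 4` it is zero and `u² / |x|⁴` itself need not be
  -- integrable.
  have iA : IntegrableOn (fun x => a * (u x ^ 2 / ‖x‖ ^ 4)) Ω := by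
    refine (hi.sub (iP.const_mul b)).congr (.of_forall fun x => ?_)
    simp only [Pi.sub_apply, Pi.mul_apply]
    ring
  refine ⟨hΔ, fun hn4 => ?_, iP, le_trans (le_of_eq ?_) hle⟩
  · have hn0 : (n : ℝ) - 4 ≠ 0 := by
      rw [sub_ne_zero]
      exact_mod_cast hn4
    have ha1 : a ≠ 0 := by positivity
    refine (iA.const_mul a⁻¹).congr (.of_forall fun x => ?_)
    simp only
    rw [inv_mul_cancel_left₀ ha1]
  -- Pulling a constant out of an integral needs no integrability, so `n = 4` is covered, where the
  -- first term is zero.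
  · rw [← integral_const_mul, ← integral_const_mul, ← integral_add iA (iP.const_mul b)]
    refine integral_congr_ae (.of_forall fun x => ?_)
    simp only [Pi.mul_apply]
    ring
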